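/- Let $G$ be a finite group acting on a field $L$ from the right, $y\mapsto y^\tau$, with fixed field $K$. Let $N$ be the kernel of this action, and put $g:=|G|$, $n:=|N|$, $h:=[L:K]$, so that $g=hn$. Assume that $n$ is invertible in $K$. Let $L\wr G$ be the twisted group ring, i.e. the $K$-algebra that is free as a right $L$-module on the elements of $G$, with multiplication $(\sigma y)(\tau z)=(\sigma\tau)(y^\tau z)$ for $\sigma,\tau\in G$ and $y,z\in L$. Let $(y_l)_{l\in[1,h]}$ be a $K$-basis of $L$ and let $(y_l^*)_{l\in[1,h]}$ be its dual basis, i.e. $\mathrm{Tr}_{L/K}(y_ly_m^*)=\delta_{l,m}$. Let $X_1,\dots,X_k$ be a complete set of pairwise nonisomorphic simple right $L\wr G$-modules. For each $i$ let $K_i:=\mathrm{End}_{L\wr G}X_i$, a skew field acting on $X_i$ from the left; let $x_i:=\dim_{K_i}X_i$; let $d_i$ be the positive integer with $d_i^2=[K_i:Z(K_i)]$ (this degree is a square); and let $\mathrm{tr}_{K_i/K}:=\mathrm{Tr}_{Z(K_i)/K}\circ\mathrm{tr}_{K_i/Z(K_i)}:K_i\to K$, where $\mathrm{tr}_{K_i/Z(K_i)}$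 is the reduced trace. Choose a $K_i$-linear basis $(v_a)_{a\in[1,x_i]}$ of each $X_i$. Write endomorphisms of $X_i$ on the right and compose them from left to right. Let $\phi_{a,b}\in K_i$ be the matrix entries of $\phi\in\mathrm{End}_{K_i}X_i$, so $v_a\phi=\sum_b\phi_{a,b}v_b$, and put $\mathrm{Tr}_{K_i}\phi:=\sum_a\phi_{a,a}$. Let $\omega_i:L\wr G\to\mathrm{End}_{K_i}X_i$ be the action of $L\wr G$ on $X_i$, and let $(\xi\omega_i)_{a,b}=:\xi\omega_{i;a,b}$. Then, for every $i$, the number $x_id_i/h$ is an integer and is invertible in $K$. Moreover, the following hold. (1) (Fourier inversion) The map $\omega:L\wr G\to\prod_{i\in[1,k]}\mathrm{End}_{K_i}X_i$, $\xi\mapsto(\xi\omega_i)_i$, is an isomorphism of $K$-algebras, with inverse $$(\phi_i)_{i\in[1,k]}\;\longmapsto\;\frac1n\sum_{\sigma\in G,\;l\in[1,h]}\sigma y_l\left[\sum_{i\in[1,k]}\frac{x_id_i}{h}\cdot\mathrm{tr}_{K_i/K}\,\mathrm{Tr}_{K_i}\big((y_l^*\sigma^{-1})\omega_i\cdot\phi_i\big)\right].$$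 (2) (Schur relations) For all $i,i'\in[1,k]$, $a,b\in[1,x_i]$ and $a',b'\in[1,x_{i'}]$, we have in $K_i$ $$\frac{g}{x_id_i}\cdot\delta_{(i;a,b),(i';a',b')}\;=\;\sum_{l\in[1,h],\;\sigma\in G}(\sigma y_l)\omega_{i;a,b}\cdot\mathrm{tr}_{K_{i'}/K}\big((y_l^*\sigma^{-1})\omega_{i';b',a'}\big),$$ where $\frac{g}{x_id_i}$ denotes the element $n\cdot(x_id_i/h)^{-1}$ of $K$. -/

import Mathlib

open scoped TensorProduct

universe u v w t

noncomputable section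

/-- The skew field structure (Schur's lemma) on the endomorphism ring of a simple module. -/
instance endSkewField (R M : Type*) [Ring R] [AddCommGroup M] [Module R M] [IsSimpleModule R M] :
    DivisionRing (Module.End R M) :=
  @Module.End.instDivisionRing R _ M _ _ (Classical.decEq _) _

/-- The center of a `K`-algebra, as a `K`-algebra. -/
instance centerAlgebra (K D : Type*) [Field K] [Ring D] [Algebra K D] :
    Algebra K (Subring.center D) where
  smul c z := ⟨c • (z : D), by
    rw [Subring.mem_center_iff]
    intro w
    rw [mul_smul_comm, smul_mul_assoc, Subring.mem_center_iff.1 z.2 w]⟩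
  algebraMap := (algebraMap K D).codRestrict _ fun c =>
    Subring.mem_center_iff.2 fun w => (Algebra.commutes c w).symm
  commutes' c z := mul_comm _ _
  smul_def' c z := Subtype.ext (Algebra.smul_def c (z : D))

instance centerIsScalarTower (K D : Type*) [Field K] [Ring D] [Algebra K D] :
    IsScalarTower K (Subring.center D) D where
  smul_assoc c z w := smul_mul_assoc c (z : D) w

/-- `t : A → F` is the reduced trace of the finite-dimensional central simple `F`-algebra `A`:
`t a` is the matrix trace of the image of `1 ⊗ a` under an identification of `F̄ ⊗ A` with a full
matrix algebra over an algebraic closure `F̄` of `F`. -/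
def IsReducedTrace (F A : Type*) [Field F] [Ring A] [Algebra F A] (t : A →ₗ[F] F) : Prop :=
  ∃ (m : ℕ) (φ : (AlgebraicClosure F ⊗[F] A) ≃ₐ[AlgebraicClosure F]
      Matrix (Fin m) (Fin m) (AlgebraicClosure F)),
    ∀ a : A, algebraMap F (AlgebraicClosure F) (t a) = (φ (1 ⊗ₜ[F] a)).trace

open Classical in
/-- The reduced trace `tr_{A/F} : A → F` of a finite-dimensional central simple `F`-algebra `A`. -/
def reducedTrace (F A : Type*) [Field F] [Ring A] [Algebra F A] : A →ₗ[F] F :=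
  if h : ∃ t : A →ₗ[F] F, IsReducedTrace F A t then h.choose else 0

/-- `tr_{D/K} = Tr_{Z(D)/K} ∘ tr_{D/Z(D)} : D → K` for a skew field `D` that is finite-dimensional
over `K`, where `tr_{D/Z(D)}` is the reduced trace and `Tr_{Z(D)/K}` is the usual trace. -/
def reducedTraceTo (K D : Type*) [Field K] [DivisionRing D] [Algebra K D] : D →ₗ[K] K :=
  Algebra.trace K (Subring.center D) ∘ₗ
    (reducedTrace (Subring.center D) D).restrictScalars K

/-- The degree `[D : Z(D)]` of a ring over its center. -/
def centerDegree (D : Type*) [Ring D] : ℕ :=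
  Module.finrank (Subring.center D) D

/-- The number `d` with `d ^ 2 = [D : Z(D)]`, for a skew field `D` that is finite-dimensional over
its center (this dimension is then a square). -/
def schurDegree (D : Type*) [Ring D] : ℕ :=
  Nat.sqrt (centerDegree D)

/-- The twisted group ring of `G` over `L`. The right operation of `G` on `L` is
`y ^ τ := τ⁻¹ • y`. The element `σ y` is `grp σ * scal y` below. -/
abbrev TwistedGroupRing (L G : Type*) [Field L] [Group G] [MulSemiringAction G L] : Type _ :=
  SkewMonoidAlgebra L G

namespace TwistedGroupRing

/-- The kernel `N` of the operation of `G` on `L`. -/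
abbrev opKernel (L G : Type*) [Field L] [Group G] [MulSemiringAction G L] : Subgroup G :=
  (MulAction.toPermHom G L).ker

section Elements

variable {L G : Type*} [Field L] [Group G] [MulSemiringAction G L]

/-- The group element `σ`, as an element of the twisted group ring. -/
def grp (σ : G) : TwistedGroupRing L G := SkewMonoidAlgebra.single σ 1

/-- The scalar `y`, as an element of the twisted group ring. -/
def scal (y : L) : TwistedGroupRing L G := SkewMonoidAlgebra.single 1 y

/-- `(σ y) (τ z) = (σ τ) (y ^ τ z)`, where `y ^ τ = τ⁻¹ • y`. -/
theorem grp_scal_mul (σ τ : G) (y z : L) :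
    (grp σ * scal y) * (grp τ * scal z) =
      (grp (σ * τ) * scal ((τ⁻¹ • y) * z) : TwistedGroupRing L G) := by
  simp [grp, scal, SkewMonoidAlgebra.single_mul_single, mul_smul]

/-- The twisted group ring is free as a right `L`-module on the elements of `G`. -/
theorem existsUnique_eq_sum [Fintype G] (ξ : TwistedGroupRing L G) :
    ∃! y : G → L, ξ = ∑ σ, grp σ * scal (y σ) := by
  have key : ∀ y : G → L, ∀ ρ : G,
      (∑ σ, (grp σ * scal (y σ) : TwistedGroupRing L G)).coeff ρ = ρ • y ρ := by
    classical
    intro y ρ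
    have h : ∀ s : Finset G, (∑ σ ∈ s, (grp σ * scal (y σ) : TwistedGroupRing L G)).coeff ρ =
        ∑ σ ∈ s, if σ = ρ then σ • y σ else 0 := by
      intro s
      induction s using Finset.induction_on with
      | empty => simp
      | insert a s ha ih =>
        rw [Finset.sum_insert ha, Finset.sum_insert ha, ← ih]
        simp [grp, scal, SkewMonoidAlgebra.single_mul_single, SkewMonoidAlgebra.coeff_single,
          Finsupp.single_apply]
    simp [h]
  refine ⟨fun σ => σ⁻¹ • ξ.coeff σ, ?_, ?_⟩
  · ext ρ
    simp [key]
  · rintro y rfl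
    funext σ
    simp [key]

end Elements

section Modules

/-- Right modules over the twisted group ring are left modules over its opposite ring. -/
abbrev RightRing (L G : Type*) [Field L] [Group G] [MulSemiringAction G L] : Type _ :=
  (TwistedGroupRing L G)ᵐᵒᵖ

variable (K L G : Type*) [Field K] [Field L] [Group G] [MulSemiringAction G L]
variable [Algebra K L] [SMulCommClass G K L]
variable (X : Type*) [AddCommGroup X] [Module (RightRing L G) X]

/-- The endomorphism ring of a right module `X` over the twisted group ring. It operates on `X`
from the left. -/
abbrev EndRing : Type _ := Module.End (RightRing L G) X

/-- The dimension `x` of a simple right module `X` as a left vector space over `EndRing L G X`. -/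
abbrev endDim : ℕ := Module.finrank (EndRing L G X) X

variable [Module K X] [IsScalarTower K (RightRing L G) X]

/-- The operation `ω_X` of the twisted group ring on a right module `X`, by endomorphisms that are
linear over the endomorphism ring of `X`. These are composed from left to right, so the target is
the opposite of the ring `Module.End (EndRing L G X) X`. -/
def operation : TwistedGroupRing L G →ₐ[K] (Module.End (EndRing L G X) X)ᵐᵒᵖ :=
  AlgHom.opComm.symm (Algebra.lsmul K (EndRing L G X) X)

theorem operation_apply (ξ : TwistedGroupRing L G) (v : X) :
    (operation K L G X ξ).unop v = MulOpposite.op ξ • v := rfl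

end Modules

/-- The map `ω = (ω_i)_i` from the twisted group ring to the product of the endomorphism rings
of the right modules `X i`, each over the respective endomorphism ring. -/
def wedderburnMap (K L G : Type*) [Field K] [Field L] [Group G] [MulSemiringAction G L]
    [Algebra K L] [SMulCommClass G K L] {k : ℕ}
    (X : Fin k → Type*) [∀ i, AddCommGroup (X i)] [∀ i, Module (RightRing L G) (X i)]
    [∀ i, Module K (X i)] [∀ i, IsScalarTower K (RightRing L G) (X i)] :
    TwistedGroupRing L G →ₐ[K] (∀ i, (Module.End (EndRing L G (X i)) (X i))ᵐᵒᵖ) :=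
  AlgHom.pi fun i => operation K L G (X i)

end TwistedGroupRing

section Matrices

variable {D X ι : Type*} [Ring D] [AddCommGroup X] [Module D X]

/-- The matrix entry `φ_{a,b}` of an endomorphism `φ` of a left `D`-module with basis `v`, written
on the right: `(v_a) φ = ∑ b, φ_{a,b} v_b`. -/
def matrixEntry (v : Module.Basis ι D X) (φ : (Module.End D X)ᵐᵒᵖ) (a b : ι) : D :=
  v.repr (φ.unop (v a)) b

/-- The trace `∑ a, φ_{a,a}` of an endomorphism `φ` with respect to a basis. -/
def matrixTrace [Fintype ι] (v : Module.Basis ι D X) (φ : (Module.End D X)ᵐᵒᵖ) : D :=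
  ∑ a, matrixEntry v φ a a

end Matrices

end

/-! The Casimir tensor `∑ y_l ⊗ y_l^*` is central over `L` and invariant under `G`. Hence `f ↦ ∑ (σ
y_l) f (y_l^* σ⁻¹)` turns a `K`-linear map between modules into one linear over the twisted group
ring (`averageHom`). Between nonisomorphic simple modules this average vanishes by Schur's lemma. On
a single module it is controlled by a trace: if `Tr z = 1`, then `tr (z · average f) = n · tr f`
(`trace_scalOp_comp_averageHom`).

The remaining point is to identify the form `δ ↦ tr (z δ)` on the skew field `K_i`. After base
change to an algebraic closure of the center, `K_i` becomes a matrix ring. The module splits into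
`h` eigenspaces of `L`, permuted by the Galois group, and each eigenspace is `r_i` copies of the
standard matrix module. So the form is `r_i` times the reduced trace, and counting dimensions gives
`x_i d_i = h r_i`. Averaging a map of rank one shows that the form is nonzero, so `r_i` is
invertible in `K`.

Since the form is nondegenerate on a skew field, the average of `w ↦ tr(χ w) v` must be `(n / r_i)
χ(v)` (`averageHom_smulRight_reducedTraceTo`). Taking coordinates gives the Schur relations. Summing
over a basis gives a right inverse of `ω`. Injectivity of `ω` comes from Maschke's theorem, again by
averaging. -/

section DualBasis

/-! ### Dual bases and the Casimir tensor. -/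

variable {K L ι : Type*} [Field K] [Field L] [Algebra K L] [Fintype ι] [DecidableEq ι]
  {y : Module.Basis ι K L} {y' : ι → L}

theorem repr_eq_trace_mul_dual
    (hy : ∀ l m, Algebra.trace K L (y l * y' m) = if l = m then 1 else 0) (z : L) (l : ι) :
    y.repr z l = Algebra.trace K L (z * y' l) := by
  conv_rhs => rw [← y.sum_repr z]
  simp only [Finset.sum_mul, smul_mul_assoc, map_sum, map_smul, hy]
  simp

theorem sum_trace_mul_dual_smul
    (hy : ∀ l m, Algebra.trace K L (y l * y' m) = if l = m then 1 else 0) (z : L) :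
    ∑ l, Algebra.trace K L (z * y' l) • y l = z := by
  simp_rw [← repr_eq_trace_mul_dual hy, y.sum_repr]

theorem eq_zero_of_trace_mul_eq_zero
    (hy : ∀ l m, Algebra.trace K L (y l * y' m) = if l = m then 1 else 0) {z : L}
    (h : ∀ a, Algebra.trace K L (a * z) = 0) : z = 0 := by
  rw [← sum_trace_mul_dual_smul hy z]
  exact Finset.sum_eq_zero fun l _ => by rw [mul_comm, h, zero_smul]

/-- The family `y'` is not known to be a basis, so the identity is tested against the trace form,
which the existence of `y'` makes nondegenerate. -/
theorem sum_trace_mul_smul_dual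
    (hy : ∀ l m, Algebra.trace K L (y l * y' m) = if l = m then 1 else 0) (z : L) :
    ∑ l, Algebra.trace K L (z * y l) • y' l = z := by
  refine sub_eq_zero.1 (eq_zero_of_trace_mul_eq_zero hy fun a => ?_)
  rw [mul_sub, map_sub, sub_eq_zero]
  conv_rhs => rw [← sum_trace_mul_dual_smul hy a]
  simp only [Finset.sum_mul, Finset.mul_sum, smul_mul_assoc, mul_smul_comm, map_sum, map_smul,
    smul_eq_mul]
  exact Finset.sum_congr rfl fun l _ => by rw [mul_comm, mul_comm z]

/-- The Casimir tensor of a pair of dual bases moves a map to its adjoint. -/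
theorem sum_dual_adjoint
    (hy : ∀ l m, Algebra.trace K L (y l * y' m) = if l = m then 1 else 0)
    {M : Type*} [AddCommGroup M] [Module K M] (β : L →ₗ[K] L →ₗ[K] M) (u v : L → L)
    (huv : ∀ a b, Algebra.trace K L (u a * b) = Algebra.trace K L (a * v b)) :
    ∑ l, β (u (y l)) (y' l) = ∑ l, β (y l) (v (y' l)) := by
  have h1 : ∀ l, β (u (y l)) (y' l) =
      ∑ m, Algebra.trace K L (u (y l) * y' m) • β (y m) (y' l) := fun l => by
    conv_lhs => rw [← sum_trace_mul_dual_smul hy (u (y l))]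
    simp
  have h2 : ∀ m, β (y m) (v (y' m)) =
      ∑ l, Algebra.trace K L (v (y' m) * y l) • β (y m) (y' l) := fun m => by
    conv_lhs => rw [← sum_trace_mul_smul_dual hy (v (y' m))]
    simp
  simp_rw [h1, h2]
  rw [Finset.sum_comm]
  refine Finset.sum_congr rfl fun m _ => Finset.sum_congr rfl fun l _ => ?_
  rw [huv, mul_comm]

/-- Multiplication by `z` is self-adjoint for the trace form. -/
theorem sum_mul_dual_comm
    (hy : ∀ l m, Algebra.trace K L (y l * y' m) = if l = m then 1 else 0)
    {M : Type*} [AddCommGroup M] [Module K M] (β : L →ₗ[K] L →ₗ[K] M) (z : L) :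
    ∑ l, β (z * y l) (y' l) = ∑ l, β (y l) (z * y' l) :=
  sum_dual_adjoint hy β (z * ·) (z * ·) fun a b => by ring_nf

theorem sum_mul_dual
    (hy : ∀ l m, Algebra.trace K L (y l * y' m) = if l = m then 1 else 0) :
    ∑ l, y l * y' l = 1 := by
  refine sub_eq_zero.1 (eq_zero_of_trace_mul_eq_zero hy fun a => ?_)
  rw [mul_sub, map_sub, sub_eq_zero, mul_one, Finset.mul_sum, map_sum,
    Algebra.trace_eq_matrix_trace y a, Matrix.trace]
  refine Finset.sum_congr rfl fun l _ => ?_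
  rw [Matrix.diag_apply, Algebra.leftMulMatrix_eq_repr_mul, repr_eq_trace_mul_dual hy, mul_assoc]

/-- Sliding `z` through the Casimir tensor gives `τ z * s = z * s` for the sum `s`; if `s ≠ 0`, then
`τ` fixes every `z`. This makes the eigenspaces of `L` for different embeddings independent. -/
theorem sum_map_mul_dual_eq_zero
    (hy : ∀ l m, Algebra.trace K L (y l * y' m) = if l = m then 1 else 0)
    {τ : L →ₐ[K] L} (hτ : τ ≠ AlgHom.id K L) : ∑ l, τ (y l) * y' l = 0 := by
  by_contra h
  refine hτ (AlgHom.ext fun z => ?_)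
  have := sum_mul_dual_comm hy
    (((LinearMap.mul K L).comp τ.toLinearMap)) z
  simp only [LinearMap.comp_apply, LinearMap.mul_apply', AlgHom.toLinearMap_apply, map_mul,
    mul_assoc, mul_left_comm _ z, ← Finset.mul_sum] at this
  simpa using mul_right_cancel₀ h this

omit [Fintype ι] in
theorem exists_trace_eq_one [Nonempty ι]
    (hy : ∀ l m, Algebra.trace K L (y l * y' m) = if l = m then 1 else 0) :
    ∃ z : L, Algebra.trace K L z = 1 :=
  let ⟨l⟩ := ‹Nonempty ι›
  ⟨y l * y' l, by simp [hy]⟩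

end DualBasis

/-! ### The possibly unfaithful action of `G` and the Galois group of `L` over `K`. -/

section GaloisAction

open TwistedGroupRing

variable (K L G : Type*) [Field K] [Field L] [Group G] [Finite G] [MulSemiringAction G L]
  [Algebra K L] [SMulCommClass G K L] [Algebra.IsInvariant K L G]

omit [Finite G] in
theorem isGaloisGroup_range_toAlgAut :
    IsGaloisGroup (MulSemiringAction.toAlgAut G K L).range K L where
  faithful := inferInstance
  commutes := inferInstance
  isInvariant := ⟨fun x hx => Algebra.IsInvariant.isInvariant (G := G) x fun g =>
    hx ⟨_, g, rfl⟩⟩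

include G in
theorem finiteDimensional_of_isInvariant : FiniteDimensional K L :=
  have := isGaloisGroup_range_toAlgAut K L G
  have := Finite.of_surjective _ (MulSemiringAction.toAlgAut G K L).rangeRestrict_surjective
  IsGaloisGroup.finiteDimensional (MulSemiringAction.toAlgAut G K L).range K L

include G in
theorem isGalois_of_isInvariant : IsGalois K L :=
  have := isGaloisGroup_range_toAlgAut K L G
  have := Finite.of_surjective _ (MulSemiringAction.toAlgAut G K L).rangeRestrict_surjective
  IsGaloisGroup.isGalois (MulSemiringAction.toAlgAut G K L).range K L

theorem toAlgAut_surjective : Function.Surjective (MulSemiringAction.toAlgAut G K L) := by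
  have := isGaloisGroup_range_toAlgAut K L G
  have := isGalois_of_isInvariant K L G
  have := finiteDimensional_of_isInvariant K L G
  rw [← MonoidHom.range_eq_top]
  apply Subgroup.eq_top_of_card_eq
  rw [IsGaloisGroup.card_eq_finrank _ K L, IsGaloisGroup.card_eq_finrank Gal(L/K) K L]

theorem MonoidHom.sum_comp_of_surjective {G H M : Type*} [Group G] [Group H] [Fintype G]
    [Fintype H] [AddCommMonoid M] (π : G →* H) (hπ : Function.Surjective π) (f : H → M) :
    ∑ σ, f (π σ) = Nat.card π.ker • ∑ τ, f τ := by
  classical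
  rw [Finset.sum_comp, Finset.image_univ_of_surjective hπ, Finset.smul_sum]
  refine Finset.sum_congr rfl fun τ _ => ?_
  rw [MonoidHom.card_fiber_eq_of_mem_range π (hπ τ) (hπ 1), Nat.card_eq_fintype_card,
    ← Fintype.card_subtype]
  exact congrArg (· • f τ) (Fintype.card_congr (Equiv.refl _))

/-- The trace is the sum over the Galois group, and each automorphism is induced by exactly `n`
elements of `G`. -/
theorem card_opKernel_smul_trace [Fintype G] (z : L) :
    Nat.card (opKernel L G) • algebraMap K L (Algebra.trace K L z) = ∑ σ : G, σ • z := by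
  have := isGalois_of_isInvariant K L G
  have := finiteDimensional_of_isInvariant K L G
  have hker : (MulSemiringAction.toAlgAut G K L).ker = opKernel L G := by
    ext σ
    simp only [MonoidHom.mem_ker, opKernel, AlgEquiv.ext_iff, Equiv.ext_iff]
    rfl
  rw [trace_eq_sum_automorphisms, ← hker]
  exact ((MulSemiringAction.toAlgAut G K L).sum_comp_of_surjective
    (toAlgAut_surjective K L G) fun τ => τ z).symm

end GaloisAction

/-! ### Splitting a central division algebra. -/

section BaseChange

variable (Z F D : Type*) [Field Z] [Field F] [Algebra Z F] [DivisionRing D] [Algebra Z D]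

open TensorProduct in
/-- A base change of a central division algebra is simple. -/
theorem isSimpleRing_tensorProduct_of_central
    (hc : ∀ d : D, (∀ w, d * w = w * d) → ∃ z, algebraMap Z D z = d) :
    IsSimpleRing (F ⊗[Z] D) := by
  classical
  let b := Module.Basis.ofVectorSpace Z F
  let e : F ⊗[Z] D ≃ₗ[Z] _ →₀ D := equivFinsuppOfBasisLeft b
  have hl : ∀ (d : D) w i, e ((1 ⊗ₜ d) * w) i = d * e w i := by
    intro d w i
    induction w with
    | zero => simp
    | tmul x y => simp [e]
    | add x y hx hy => simp [mul_add, hx, hy]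
  have hr : ∀ (d : D) w i, e (w * (1 ⊗ₜ d)) i = e w i * d := by
    intro d w i
    induction w with
    | zero => simp
    | tmul x y => simp [e]
    | add x y hx hy => simp [add_mul, hx, hy]
  refine IsSimpleRing.of_eq_bot_or_eq_top fun I => ?_
  -- Shortest-element argument: after scaling one coefficient to `1`, either `w₁` commutes with `1 ⊗
  -- D`, so its coefficients are central and it is a unit `f ⊗ 1`, or a commutator with some `1 ⊗ d`
  -- is nonzero and has smaller support, losing the index `i₀`.
  have key : ∀ n : ℕ, ∀ w ∈ I, w ≠ 0 → (e w).support.card = n → (1 : F ⊗[Z] D) ∈ I := by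
    intro n
    induction n using Nat.strong_induction_on with
    | _ n ih =>
      intro w hw hw0 hn
      obtain ⟨i₀, hi₀⟩ : ∃ i, e w i ≠ 0 := by
        by_contra! h
        exact hw0 (e.map_eq_zero_iff.1 (Finsupp.ext h))
      set w₁ : F ⊗[Z] D := (1 ⊗ₜ (e w i₀)⁻¹) * w with hw₁
      have hw₁I : w₁ ∈ I := I.mul_mem_left _ _ hw
      have hw₁i : e w₁ i₀ = 1 := by rw [hw₁, hl, inv_mul_cancel₀ hi₀]
      by_cases hcomm : ∀ d : D, (1 ⊗ₜ d) * w₁ = w₁ * (1 ⊗ₜ d)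
      · choose c hcz using fun i => hc (e w₁ i) fun d => by rw [← hl, ← hr, hcomm]
        obtain ⟨f, hf⟩ : ∃ f : F, w₁ = f ⊗ₜ 1 := by
          refine ⟨∑ i ∈ (e w₁).support, c i • b i, ?_⟩
          rw [← e.symm_apply_apply w₁, e.apply_symm_apply]
          simp only [e, equivFinsuppOfBasisLeft_symm_apply, Finsupp.sum, sum_tmul]
          refine Finset.sum_congr rfl fun i _ => ?_
          rw [smul_tmul, ← Algebra.algebraMap_eq_smul_one, hcz]
        have hf0 : f ≠ 0 := by
          rintro rfl
          simp [hf] at hw₁i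
        have := I.mul_mem_left (f⁻¹ ⊗ₜ 1) _ hw₁I
        rwa [hf, Algebra.TensorProduct.tmul_mul_tmul, inv_mul_cancel₀ hf0, one_mul,
          ← Algebra.TensorProduct.one_def] at this
      · push Not at hcomm
        obtain ⟨d, hd⟩ := hcomm
        refine ih _ ?_ _ (I.sub_mem (I.mul_mem_left (1 ⊗ₜ d) _ hw₁I)
          (I.mul_mem_right _ (1 ⊗ₜ d) hw₁I)) (sub_ne_zero.2 hd) rfl
        rw [← hn]
        refine Finset.card_lt_card (Finset.ssubset_iff_of_subset ?_ |>.2 ⟨i₀, ?_, ?_⟩)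
        · intro i hi
          rw [Finsupp.mem_support_iff] at hi ⊢
          contrapose! hi
          simp [hl, hr, hw₁, hi]
        · simpa using hi₀
        · simp [hl, hr, hw₁i]
  by_cases h : ∃ w ∈ I, w ≠ 0
  · obtain ⟨w, hw, hw0⟩ := h
    exact Or.inr (I.one_mem_iff.1 (key _ w hw hw0 rfl))
  · push Not at h
    exact Or.inl (le_bot_iff.1 fun w hw => (TwoSidedIdeal.mem_bot _).2 (h w hw))

/-- An algebraically closed extension splits a central division algebra. -/
theorem exists_algEquiv_matrix_of_central [IsAlgClosed F] [FiniteDimensional Z D]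
    (hc : ∀ d : D, (∀ w, d * w = w * d) → ∃ z, algebraMap Z D z = d) :
    ∃ m : ℕ, Nonempty ((F ⊗[Z] D) ≃ₐ[F] Matrix (Fin m) (Fin m) F) := by
  have := isSimpleRing_tensorProduct_of_central Z F D hc
  obtain ⟨m, _, h⟩ := IsSimpleRing.exists_algEquiv_matrix_of_isAlgClosed F (F ⊗[Z] D)
  exact ⟨m, h⟩

variable {Z F D}

theorem sq_eq_finrank_of_algEquiv_matrix {m : ℕ}
    (φ : (F ⊗[Z] D) ≃ₐ[F] Matrix (Fin m) (Fin m) F) : m ^ 2 = Module.finrank Z D := by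
  rw [← Module.finrank_baseChange (R := F), φ.toLinearEquiv.finrank_eq, Module.finrank_matrix]
  simp [sq]

end BaseChange

/-! ### Trace forms on matrix rings. -/

section MatrixTrace

/-- A linear form on a matrix ring that vanishes on commutators is a multiple of the trace. -/
theorem Matrix.linearForm_eq_smul_trace {F n : Type*} [Field F] [Fintype n] [DecidableEq n]
    (s : Matrix n n F →ₗ[F] F) (hs : ∀ A B, s (A * B) = s (B * A)) (i : n) (A : Matrix n n F) :
    s A = s (Matrix.single i i 1) * A.trace := by
  conv_lhs => rw [Matrix.matrix_eq_sum_single A]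
  simp only [map_sum, Matrix.trace, Finset.mul_sum, Matrix.diag_apply]
  refine Finset.sum_congr rfl fun a _ => ?_
  have h : ∀ c, s (Matrix.single a c (A a c)) = if a = c then s (Matrix.single i i 1) * A a a
      else 0 := by
    intro c
    -- Factor through the index `i`, so that swapping the factors lands in the entry `(i, i)` or
    -- gives zero.
    have h1 : Matrix.single a c (A a c) = Matrix.single a i (A a c) * Matrix.single i c 1 := by
      simp
    rw [h1, hs]
    split_ifs with hac
    · subst hac
      have h2 : Matrix.single i i (1 * A a a) = A a a • Matrix.single i i (1 : F) := by simp
      rw [Matrix.single_mul_single_same, h2, map_smul, smul_eq_mul, mul_comm]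
    · rw [Matrix.single_mul_single_of_ne _ _ _ _ (Ne.symm hac), map_zero]
  simp [h]

end MatrixTrace

/-! ### Counting multiplicities from relations of matrix-unit type. -/

section Multiplicity

/-- A system of maps that identifies `V` with a power of the image of `ε`. -/
theorem exists_finrank_eq_card_mul_and_trace_eq {F V ι : Type*} [Field F] [AddCommGroup V]
    [Module F V] [FiniteDimensional F V] [Fintype ι] [DecidableEq ι] (i₀ : ι)
    (p q : ι → Module.End F V) (ε : Module.End F V)
    (hpq : ∀ i j, p i * q j = if i = j then ε else 0) (hqp : ∑ i, q i * p i = 1) :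
    ∃ r : ℕ, Module.finrank F V = Fintype.card ι * r ∧ LinearMap.trace F V ε = r := by
  have hεp : ∀ i, ε * p i = p i := by
    intro i
    calc ε * p i = ∑ j, (p i * q j) * p j := by simp [hpq]
      _ = p i := by simp_rw [mul_assoc]; rw [← Finset.mul_sum, hqp, mul_one]
  have hqε : ∀ i, q i * ε = q i := by
    intro i
    calc q i * ε = ∑ j, q j * (p j * q i) := by simp [hpq]
      _ = q i := by simp_rw [← mul_assoc]; rw [← Finset.sum_mul, hqp, one_mul]
  have hε : ∀ x ∈ LinearMap.range ε, ε x = x := by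
    rintro _ ⟨x, rfl⟩
    have h : ε = p i₀ * q i₀ := by simp [hpq]
    rw [← Module.End.mul_apply]
    nth_rewrite 2 [h]
    rw [← mul_assoc, hεp, ← h]
  have hproj : LinearMap.IsProj (LinearMap.range ε) ε := ⟨fun x => ⟨x, rfl⟩, hε⟩
  refine ⟨Module.finrank F (LinearMap.range ε), ?_, hproj.trace⟩
  let P : V →ₗ[F] (ι → LinearMap.range ε) :=
    LinearMap.pi fun i => (p i).codRestrict _ fun x => ⟨p i x, LinearMap.congr_fun (hεp i) x⟩
  let Q : (ι → LinearMap.range ε) →ₗ[F] V :=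
    ∑ i, q i ∘ₗ (LinearMap.range ε).subtype ∘ₗ LinearMap.proj i
  have hQ : ∀ u, Q u = ∑ i, q i (u i) := fun u => by simp [Q]
  have hPQ : ∀ u, P (Q u) = u := by
    refine fun u => funext fun j => Subtype.ext ?_
    change p j (Q u) = u j
    have : ∀ i, p j (q i (u i)) = if j = i then (u i : V) else 0 := fun i => by
      rw [← Module.End.mul_apply, hpq]
      split_ifs
      · exact hε _ (u i).2
      · rfl
    simp [hQ, this]
  have hQP : ∀ x, Q (P x) = x := by
    intro x
    rw [hQ]
    exact (by simp : ∑ i, q i (p i x) = (∑ i, q i * p i) x).trans (by rw [hqp]; rfl)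
  let e : V ≃ₗ[F] (ι → LinearMap.range ε) :=
    { P with invFun := Q, left_inv := hQP, right_inv := hPQ }
  rw [e.finrank_eq, Module.finrank_pi_fintype]
  simp

end Multiplicity

/-! ### Characters of semilinear representations. -/

section SemilinearAction

open TwistedGroupRing

variable {K L G ι : Type*} [Field K] [Field L] [Group G] [MulSemiringAction G L]
  [Algebra K L] [SMulCommClass G K L] [Algebra.IsInvariant K L G]

/-- If `δ` commutes with a semilinear action of `G`, then `a ↦ tr (a δ)` factors over
the trace of `L` over `K`. -/
theorem trace_mul_eq_trace_mul_trace [Fintype G]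
    (hn : ((Nat.card (opKernel L G) : ℕ) : K) ≠ 0)
    {Z V : Type*} [Field Z] [Algebra K Z] [AddCommGroup V] [Module Z V]
    (lam : L →+* Module.End Z V) (g : G →* Module.End Z V)
    (hlam : ∀ c : K, lam (algebraMap K L c) = algebraMap K Z c • 1)
    (hg : ∀ σ a, g σ * lam a = lam (σ • a) * g σ)
    (δ : Module.End Z V) (hδ : ∀ σ, δ * g σ = g σ * δ)
    {z : L} (hz : Algebra.trace K L z = 1) (a : L) :
    LinearMap.trace Z V (lam a * δ) =
      algebraMap K Z (Algebra.trace K L a) * LinearMap.trace Z V (lam z * δ) := by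
  have hn' : ((Nat.card (opKernel L G) : ℕ) : Z) ≠ 0 := by
    rw [← map_natCast (algebraMap K Z)]
    exact (map_ne_zero _).2 hn
  -- Conjugation by `g σ` fixes `δ` and carries `lam b` to `lam (σ • b)`.
  have hinv : ∀ (σ : G) (b : L),
      LinearMap.trace Z V (lam (σ • b) * δ) = LinearMap.trace Z V (lam b * δ) := by
    intro σ b
    have h1 : lam (σ • b) * δ = g σ * (lam b * δ * g σ⁻¹) := by
      rw [mul_assoc (lam b), hδ, ← mul_assoc, ← mul_assoc, hg, mul_assoc (lam _), ← map_mul,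
        mul_inv_cancel, map_one, mul_one]
    rw [h1, LinearMap.trace_mul_comm, mul_assoc, ← map_mul, inv_mul_cancel, map_one, mul_one]
  have hK : ∀ (c : K) b, LinearMap.trace Z V (lam (algebraMap K L c * b) * δ) =
      algebraMap K Z c * LinearMap.trace Z V (lam b * δ) := by
    intro c b
    rw [map_mul lam, hlam, smul_mul_assoc, one_mul, smul_mul_assoc, map_smul, smul_eq_mul]
  have hnat : ∀ (c : ℕ) b, LinearMap.trace Z V (lam (c • b) * δ) =
      c * LinearMap.trace Z V (lam b * δ) := by
    intro c b
    rw [nsmul_eq_mul, ← map_natCast (algebraMap K L), hK, map_natCast]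
  -- After multiplication by `n`, both sides are sums over `G`: the traces of `(σ • a) z` and of `a
  -- (σ • z)`. These agree by invariance and `σ ↦ σ⁻¹`.
  refine mul_left_cancel₀ hn' ?_
  rw [← hK, ← hnat, ← hnat, ← smul_mul_assoc, card_opKernel_smul_trace K L G a]
  have h2 : Nat.card (opKernel L G) • a = ∑ σ : G, a * σ • z := by
    rw [← Finset.mul_sum, ← card_opKernel_smul_trace K L G z, hz, map_one, mul_smul_comm, mul_one]
  rw [h2, map_sum, Finset.sum_mul, map_sum, Finset.sum_mul, map_sum, Finset.sum_mul, map_sum,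
    ← Equiv.sum_comp (Equiv.inv G)]
  refine Finset.sum_congr rfl fun σ _ => ?_
  rw [← hinv σ]
  simp

variable [Finite G] [Fintype ι] [DecidableEq ι] {y : Module.Basis ι K L} {y' : ι → L}

/-- A vector space with a semilinear action of `G` and a commuting action of a matrix ring:
its dimension, and the character of the matrix ring on an eigenspace of `L`. -/
theorem exists_finrank_eq_and_trace_eq_of_matrix
    (hy : ∀ l m, Algebra.trace K L (y l * y' m) = if l = m then 1 else 0)
    {F W n : Type*} [Field F] [Algebra K F] [AddCommGroup W] [Module F W] [FiniteDimensional F W]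
    [Fintype n] [DecidableEq n] [Nonempty n]
    (φ₀ : L →ₐ[K] F)
    (lam : L →+* Module.End F W) (g : G →* Module.End F W)
    (hlam : ∀ c : K, lam (algebraMap K L c) = algebraMap K F c • 1)
    (hg : ∀ σ a, g σ * lam a = lam (σ • a) * g σ)
    (Ψ : Matrix n n F →ₐ[F] Module.End F W)
    (hΨl : ∀ A a, Commute (Ψ A) (lam a)) (hΨg : ∀ A σ, Commute (Ψ A) (g σ)) :
    ∃ r : ℕ, Module.finrank F W = Module.finrank K L * Fintype.card n * r ∧
      ∀ A, LinearMap.trace F W ((∑ l, φ₀ (y' l) • lam (y l)) * Ψ A) = r * A.trace := by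
  classical
  have := isGalois_of_isInvariant K L G
  have := finiteDimensional_of_isInvariant K L G
  -- The idempotent projecting onto the subspace where `L` acts through `φ₀`.
  set e : Module.End F W := ∑ l, φ₀ (y' l) • lam (y l) with he
  let _ : Module K (Module.End F W) := Module.compHom _ (algebraMap K F)
  have hsm : ∀ (c : K) (f : Module.End F W), c • f = algebraMap K F c • f := fun _ _ => rfl
  have hea : ∀ a, e * lam a = φ₀ a • e := by
    intro a
    have := sum_mul_dual_comm hy (LinearMap.mk₂ K (fun b d => φ₀ d • lam b)
      (fun _ _ _ => by rw [map_add, smul_add])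
      (fun k b d => by
        rw [Algebra.smul_def k b, map_mul, hlam, smul_mul_assoc, one_mul, smul_comm, hsm])
      (fun _ _ _ => by rw [map_add, add_smul])
      (fun k b d => by rw [map_smul, Algebra.smul_def k, mul_smul, hsm])) a
    simp only [LinearMap.mk₂_apply] at this
    simp only [he, Finset.sum_mul, Finset.smul_sum, smul_mul_assoc, ← map_mul, smul_smul]
    simpa only [mul_comm _ a] using this
  have hΨe : ∀ A, Commute (Ψ A) e := fun A =>
    Commute.sum_right _ _ _ fun l _ => (hΨl A _).smul_right _
  have hege : ∀ σ, MulSemiringAction.toAlgAut G K L σ ≠ 1 → e * g σ * e = 0 := by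
    intro σ hσ
    have h0 := sum_map_mul_dual_eq_zero hy
      (τ := (MulSemiringAction.toAlgAut G K L σ : L →ₐ[K] L)) fun h => hσ (AlgEquiv.ext fun a =>
        DFunLike.congr_fun h a)
    have h1 : e * g σ * e = φ₀ (∑ l, (σ • y l) * y' l) • (e * g σ) := by
      conv_lhs => rw [he, Finset.mul_sum, ← he]
      rw [map_sum, Finset.sum_smul]
      refine Finset.sum_congr rfl fun l _ => ?_
      rw [mul_smul_comm, mul_assoc, hg, ← mul_assoc, hea, smul_mul_assoc, smul_smul, map_mul,
        mul_comm]
    rw [h1, show ∑ l, (σ • y l) * y' l = 0 from h0, map_zero, zero_smul]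
  have hee : e * e = e := by
    conv_lhs => rw [he, Finset.mul_sum, ← he]
    simp only [mul_smul_comm, hea, smul_smul, ← map_mul, ← Finset.sum_smul, ← map_sum]
    simp only [mul_comm (y' _), sum_mul_dual hy, map_one, one_smul]
  -- One lift per Galois automorphism suffices: the conjugates of `e` by these lifts are the
  -- projections onto all the eigenspaces of `L`.
  choose c hc using toAlgAut_surjective K L G
  have hsum : ∑ τ, g (c τ)⁻¹ * e * g (c τ) = 1 := by
    have h1 : ∀ τ : Gal(L/K), g (c τ)⁻¹ * e * g (c τ) = ∑ l, φ₀ (y' l) • lam (τ⁻¹ (y l)) := by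
      intro τ
      have h2 : ∀ a, (c τ)⁻¹ • a = τ⁻¹ a := fun a => by
        conv_rhs => rw [← hc τ, ← map_inv]
        rfl
      rw [he, Finset.mul_sum, Finset.sum_mul]
      refine Finset.sum_congr rfl fun l _ => ?_
      rw [mul_smul_comm, smul_mul_assoc, hg, mul_assoc, ← map_mul, inv_mul_cancel, map_one,
        mul_one, h2]
    simp only [h1]
    rw [Finset.sum_comm]
    have h3 : ∀ l, ∑ τ : Gal(L/K), φ₀ (y' l) • lam (τ⁻¹ (y l)) =
        φ₀ (Algebra.trace K L (1 * y l) • y' l) • 1 := by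
      intro l
      have h4 : ∑ τ : Gal(L/K), τ⁻¹ (y l) = ∑ τ : Gal(L/K), τ (y l) :=
        Equiv.sum_comp (Equiv.inv Gal(L/K)) fun τ => τ (y l)
      rw [← Finset.smul_sum, ← map_sum, h4, ← trace_eq_sum_automorphisms, hlam, smul_smul, one_mul,
        map_smul, Algebra.smul_def (Algebra.trace K L (y l)), mul_comm]
    simp only [h3]
    rw [← Finset.sum_smul, ← map_sum, sum_trace_mul_smul_dual hy, map_one, one_smul]
  obtain ⟨i₀⟩ := ‹Nonempty n›
  have hEE : ∀ i j k l : n, Ψ (Matrix.single i j 1) * Ψ (Matrix.single k l 1) =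
      if j = k then Ψ (Matrix.single i l 1) else 0 := by
    intro i j k l
    rw [← map_mul]
    split_ifs with h
    · subst h; rw [Matrix.single_mul_single_same, one_mul]
    · rw [Matrix.single_mul_single_of_ne _ _ _ _ h, map_zero]
  -- Eigenspaces and matrix units together cut `W` into `h * card n` isomorphic copies of the image
  -- of `e * Ψ (E i₀ i₀)`, of dimension `r`.
  obtain ⟨r, hr, htr⟩ := exists_finrank_eq_card_mul_and_trace_eq (F := F) (V := W)
    (ι := Gal(L/K) × n) (1, i₀)
    (fun t => Ψ (Matrix.single i₀ t.2 1) * (e * g (c t.1)))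
    (fun t => g (c t.1)⁻¹ * e * Ψ (Matrix.single t.2 i₀ 1))
    (e * Ψ (Matrix.single i₀ i₀ 1))
    (by
      rintro ⟨τ, j⟩ ⟨τ', j'⟩
      have h1 : Ψ (Matrix.single i₀ j 1) * (e * g (c τ)) *
          (g (c τ')⁻¹ * e * Ψ (Matrix.single j' i₀ 1)) =
          e * g (c τ * (c τ')⁻¹) * e * (Ψ (Matrix.single i₀ j 1) * Ψ (Matrix.single j' i₀ 1)) := by
        have h2 : Commute (Ψ (Matrix.single i₀ j 1)) (e * g (c τ * (c τ')⁻¹) * e) :=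
          ((hΨe _).mul_right (hΨg _ _)).mul_right (hΨe _)
        rw [← mul_assoc (e * _ * e), ← h2.eq, map_mul]
        simp only [mul_assoc]
      rw [h1, hEE]
      by_cases hτ : τ = τ'
      · subst hτ
        rw [mul_inv_cancel, map_one, mul_one, hee]
        by_cases hj : j = j' <;> simp [hj]
      · rw [hege _ (by rw [map_mul, map_inv, hc, hc]; rwa [Ne, mul_inv_eq_one]), zero_mul,
          if_neg (by simp [hτ])])
    (by
      rw [Fintype.sum_prod_type]
      rw [← hsum]
      refine Finset.sum_congr rfl fun τ _ => ?_
      have h1 : ∀ j, g (c τ)⁻¹ * e * Ψ (Matrix.single j i₀ 1) *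
          (Ψ (Matrix.single i₀ j 1) * (e * g (c τ))) =
          g (c τ)⁻¹ * e * (Ψ (Matrix.single j j 1) * (e * g (c τ))) := by
        intro j
        have := hEE j i₀ i₀ j
        rw [if_pos rfl] at this
        rw [← this]
        simp only [mul_assoc]
      simp only [h1]
      rw [← Finset.mul_sum, ← Finset.sum_mul, ← map_sum, Matrix.sum_single_one, map_one, one_mul,
        ← mul_assoc, mul_assoc _ e e, hee])
  refine ⟨r, ?_, fun A => ?_⟩
  · rw [hr, Fintype.card_prod, ← Nat.card_eq_fintype_card (α := Gal(L/K)),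
      IsGaloisGroup.card_eq_finrank Gal(L/K) K L]
  · have := Matrix.linearForm_eq_smul_trace
      (LinearMap.trace F W ∘ₗ LinearMap.mulLeft F e ∘ₗ Ψ.toLinearMap) (fun A B => by
        simp only [LinearMap.comp_apply, LinearMap.mulLeft_apply, AlgHom.toLinearMap_apply,
          map_mul]
        rw [← mul_assoc, LinearMap.trace_mul_comm, ← mul_assoc, (hΨe B).eq, mul_assoc]) i₀ A
    simp only [LinearMap.comp_apply, LinearMap.mulLeft_apply, AlgHom.toLinearMap_apply, htr]
      at this
    exact this

end SemilinearAction

/-! ### From the algebraic closure back to the center: comparison with the reduced trace. -/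

section Descent

open TwistedGroupRing

variable {K L G ι : Type*} [Field K] [Field L] [Group G] [MulSemiringAction G L]
  [Algebra K L] [SMulCommClass G K L] [Algebra.IsInvariant K L G]
  [Fintype G] [Fintype ι] [DecidableEq ι] {y : Module.Basis ι K L} {y' : ι → L}

/-- Let a central division algebra `D` over `Z`, split by `F`, operate on a `Z`-vector space with
a semilinear action of `G`. Then the form `d ↦ tr (z d)` with `Tr z = 1` is an integral multiple
of the matrix trace over `F`. -/
theorem exists_finrank_eq_and_trace_eq
    (hn : ((Nat.card (opKernel L G) : ℕ) : K) ≠ 0)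
    (hy : ∀ l m, Algebra.trace K L (y l * y' m) = if l = m then 1 else 0)
    {Z F D V : Type*} [Field Z] [Algebra K Z] [Field F] [IsAlgClosed F] [Algebra Z F]
    [Algebra K F] [IsScalarTower K Z F] [Ring D] [Nontrivial D] [Algebra Z D] [AddCommGroup V]
    [Module Z V] [FiniteDimensional Z V]
    (lam : L →+* Module.End Z V) (g : G →* Module.End Z V)
    (hlam : ∀ c : K, lam (algebraMap K L c) = algebraMap K Z c • 1)
    (hg : ∀ σ a, g σ * lam a = lam (σ • a) * g σ)
    (del : D →ₐ[Z] Module.End Z V) (hdl : ∀ d a, Commute (del d) (lam a))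
    (hdg : ∀ d σ, Commute (del d) (g σ))
    {z : L} (hz : Algebra.trace K L z = 1)
    {m : ℕ} (φ : (F ⊗[Z] D) ≃ₐ[F] Matrix (Fin m) (Fin m) F) :
    ∃ r : ℕ, Module.finrank Z V = Module.finrank K L * m * r ∧
      ∀ d, algebraMap Z F (LinearMap.trace Z V (lam z * del d)) =
        r * (φ (1 ⊗ₜ[Z] d)).trace := by
  have := finiteDimensional_of_isInvariant K L G
  let φ₀ : L →ₐ[K] F := IsAlgClosed.lift
  let B := Module.End.baseChangeHom Z F V
  let Δ : F ⊗[Z] D →ₐ[F] Module.End F (F ⊗[Z] V) :=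
    Algebra.TensorProduct.lift (Algebra.ofId F _) (B.comp del) fun x d =>
      Algebra.commutes x _
  have hΔt : ∀ x d, Δ (x ⊗ₜ d) = algebraMap F _ x * B (del d) := fun x d =>
    Algebra.TensorProduct.lift_tmul _ _ _ _ _
  have hΔ : ∀ d, Δ (1 ⊗ₜ d) = B (del d) := fun d => by rw [hΔt, map_one, one_mul]
  have hcomm : ∀ T : Module.End F (F ⊗[Z] V), (∀ d, Commute (B (del d)) T) →
      ∀ w, Commute (Δ w) T := by
    intro T hT w
    induction w with
    | zero => rw [map_zero]; exact Commute.zero_left _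
    | add x y hx hy => rw [map_add]; exact hx.add_left hy
    | tmul x d =>
      rw [hΔt]
      exact Commute.mul_left (Algebra.commutes x T) (hT d)
  have hm : Nonempty (Fin m) := by
    by_contra h
    rw [not_nonempty_iff] at h
    have : Subsingleton (F ⊗[Z] D) := φ.injective.subsingleton
    exact not_subsingleton (F ⊗[Z] D) this
  obtain ⟨r, hr, htr⟩ := exists_finrank_eq_and_trace_eq_of_matrix (G := G) hy φ₀
    ((B : _ →+* Module.End F (F ⊗[Z] V)).comp lam) ((B : _ →* Module.End F (F ⊗[Z] V)).comp g)
    (fun c => by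
      change B (lam _) = _
      rw [hlam, map_smul, map_one, IsScalarTower.algebraMap_apply K Z F]
      exact (algebraMap_smul F (algebraMap K Z c) _).symm)
    (fun σ a => by
      change B (g σ) * B (lam a) = B (lam _) * B (g σ)
      rw [← map_mul, hg, map_mul])
    (Δ.comp φ.symm.toAlgHom)
    (fun A a => hcomm _ (fun d => (hdl d a).map B) _)
    (fun A σ => hcomm _ (fun d => (hdg d σ).map B) _)
  refine ⟨r, ?_, fun d => ?_⟩
  · rw [← Module.finrank_baseChange (R := F), hr, Fintype.card_fin]
  · rw [← htr]
    have h1 : (Δ.comp φ.symm.toAlgHom) (φ (1 ⊗ₜ[Z] d)) = B (del d) := by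
      simp [← hΔ]
    -- By `trace_mul_eq_trace_mul_trace`, the trace of `e` times `del d` has the factor `φ₀ (∑
    -- Tr(y_l) y_l^*) = φ₀ 1 = 1`, so it equals that of `lam z * del d`.
    have h2 : ∀ l, LinearMap.trace F (F ⊗[Z] V) (B (lam (y l)) * B (del d)) =
        φ₀ (algebraMap K L (Algebra.trace K L (1 * y l))) *
          algebraMap Z F (LinearMap.trace Z V (lam z * del d)) := by
      intro l
      rw [← map_mul]
      refine (LinearMap.trace_baseChange _ F).trans ?_
      rw [trace_mul_eq_trace_mul_trace hn lam g hlam hg (del d) (fun σ => (hdg d σ).eq) hz,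
        one_mul, map_mul, AlgHom.commutes, IsScalarTower.algebraMap_apply K Z F]
    rw [h1, Finset.sum_mul, map_sum]
    simp only [smul_mul_assoc, map_smul, RingHom.comp_apply, RingHom.coe_coe, h2]
    simp only [smul_eq_mul, ← mul_assoc, ← map_mul, ← Finset.sum_mul, ← map_sum,
      mul_comm (y' _), ← Algebra.smul_def]
    have h3 := sum_trace_mul_smul_dual hy 1
    simp only [one_mul] at h3 ⊢
    rw [h3, map_one, one_mul]

/-- `reducedTrace` comes with its own splitting, chosen once a reduced trace is known to exist. The
multiplicity does not depend on the splitting: `m` is fixed by the dimension of `D`, then `r` by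
that of `V`. -/
theorem exists_trace_eq_mul_reducedTrace
    (hn : ((Nat.card (opKernel L G) : ℕ) : K) ≠ 0)
    (hy : ∀ l m, Algebra.trace K L (y l * y' m) = if l = m then 1 else 0)
    {Z D V : Type*} [Field Z] [Algebra K Z] [DivisionRing D] [Algebra Z D] [FiniteDimensional Z D]
    (hc : ∀ d : D, (∀ w, d * w = w * d) → ∃ z, algebraMap Z D z = d)
    [AddCommGroup V] [Module Z V] [FiniteDimensional Z V]
    (lam : L →+* Module.End Z V) (g : G →* Module.End Z V)
    (hlam : ∀ c : K, lam (algebraMap K L c) = algebraMap K Z c • 1)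
    (hg : ∀ σ a, g σ * lam a = lam (σ • a) * g σ)
    (del : D →ₐ[Z] Module.End Z V) (hdl : ∀ d a, Commute (del d) (lam a))
    (hdg : ∀ d σ, Commute (del d) (g σ))
    {z : L} (hz : Algebra.trace K L z = 1)
    (hne : ∃ d, LinearMap.trace Z V (lam z * del d) ≠ 0) :
    ∃ m r : ℕ, m ^ 2 = Module.finrank Z D ∧ 0 < m ∧
      Module.finrank Z V = Module.finrank K L * m * r ∧ (r : Z) ≠ 0 ∧
      ∀ d, LinearMap.trace Z V (lam z * del d) = r * reducedTrace Z D d := by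
  have := finiteDimensional_of_isInvariant K L G
  have core := fun (m : ℕ) (φ : (AlgebraicClosure Z ⊗[Z] D) ≃ₐ[AlgebraicClosure Z]
      Matrix (Fin m) (Fin m) (AlgebraicClosure Z)) =>
    exists_finrank_eq_and_trace_eq (F := AlgebraicClosure Z) hn hy lam g hlam hg del hdl hdg hz φ
  obtain ⟨m, ⟨φ⟩⟩ := exists_algEquiv_matrix_of_central Z (AlgebraicClosure Z) D hc
  have hm := sq_eq_finrank_of_algEquiv_matrix φ
  obtain ⟨r, hr, htr⟩ := core m φ
  have hmpos : 0 < m := by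
    have : 0 < Module.finrank Z D := Module.finrank_pos
    rw [← hm] at this
    exact Nat.pos_of_ne_zero fun h => by simp [h] at this
  have hrF : (r : AlgebraicClosure Z) ≠ 0 := by
    intro h0
    obtain ⟨d, hd⟩ := hne
    have := htr d
    rw [h0, zero_mul, map_eq_zero] at this
    exact hd this
  have hrZ : (r : Z) ≠ 0 := fun h => hrF (by
    rw [← map_natCast (algebraMap Z (AlgebraicClosure Z)), h, map_zero])
  -- The form divided by `r` is itself a reduced trace, so the default value `0` of `reducedTrace`
  -- does not occur.
  have hex : ∃ t : D →ₗ[Z] Z, IsReducedTrace Z D t := by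
    refine ⟨(r : Z)⁻¹ • (LinearMap.trace Z V ∘ₗ LinearMap.mulLeft Z (lam z) ∘ₗ del.toLinearMap),
      m, φ, fun a => ?_⟩
    change algebraMap Z (AlgebraicClosure Z) ((r : Z)⁻¹ * LinearMap.trace Z V (lam z * del a)) = _
    rw [map_mul, htr, map_inv₀, map_natCast, inv_mul_cancel_left₀ hrF]
  refine ⟨m, r, hm, hmpos, hr, hrZ, fun a => ?_⟩
  have hspec : IsReducedTrace Z D (reducedTrace Z D) := by
    rw [reducedTrace, dif_pos hex]
    exact hex.choose_spec
  obtain ⟨m', φ', h'⟩ := hspec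
  obtain ⟨r', hr', htr'⟩ := core m' φ'
  have hm' := sq_eq_finrank_of_algEquiv_matrix φ'
  obtain rfl : m' = m := Nat.pow_left_injective (n := 2) (by norm_num) (hm'.trans hm.symm)
  obtain rfl : r' = r :=
    Nat.eq_of_mul_eq_mul_left (Nat.mul_pos Module.finrank_pos hmpos) (hr'.symm.trans hr)
  apply (algebraMap Z (AlgebraicClosure Z)).injective
  rw [htr', ← h', map_mul, map_natCast]

end Descent

/-! ### Transitivity of traces. -/

section TraceTower

/-- The trace of a `Z`-linear map, over a subfield `K`. -/
theorem LinearMap.trace_restrictScalars_eq {K Z V : Type*} [Field K] [Field Z] [Algebra K Z]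
    [FiniteDimensional K Z] [AddCommGroup V] [Module K V] [Module Z V] [IsScalarTower K Z V]
    [FiniteDimensional Z V] (f : V →ₗ[Z] V) :
    LinearMap.trace K V (f.restrictScalars K) = Algebra.trace K Z (LinearMap.trace Z V f) := by
  classical
  let b := Module.finBasis K Z
  let c := Module.finBasis Z V
  rw [LinearMap.trace_eq_matrix_trace K (b.smulTower c), LinearMap.trace_eq_matrix_trace Z c,
    Matrix.trace, Matrix.trace, map_sum, Fintype.sum_prod_type_right]
  refine Finset.sum_congr rfl fun j _ => ?_
  rw [Algebra.trace_eq_matrix_trace b, Matrix.trace]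
  refine Finset.sum_congr rfl fun i _ => ?_
  simp [LinearMap.toMatrix_apply, Algebra.leftMulMatrix_eq_repr_mul, mul_comm]

end TraceTower

namespace TwistedGroupRing

/-! ### Generators of the opposite of the twisted group ring. -/

section RightRing

variable {K L G : Type*} [Field K] [Field L] [Group G] [MulSemiringAction G L]

/-- The scalars, as elements of the opposite of the twisted group ring. -/
noncomputable def scalOp (L G : Type*) [Field L] [Group G] [MulSemiringAction G L] :
    L →+* RightRing L G where
  toFun a := MulOpposite.op (scal a)
  map_one' := rfl
  map_mul' a b := by
    rw [← MulOpposite.op_mul, mul_comm]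
    simp [scal, SkewMonoidAlgebra.single_mul_single]
  map_zero' := by simp [scal]
  map_add' a b := by
    rw [← MulOpposite.op_add]
    simp [scal, SkewMonoidAlgebra.single_add]

/-- The inverses of the group elements, as elements of the opposite of the twisted group ring. -/
noncomputable def grpOp (L G : Type*) [Field L] [Group G] [MulSemiringAction G L] :
    G →* RightRing L G where
  toFun σ := MulOpposite.op (grp σ⁻¹)
  map_one' := by rw [inv_one]; rfl
  map_mul' a b := by
    rw [← MulOpposite.op_mul]
    simp [grp, SkewMonoidAlgebra.single_mul_single]

theorem grpOp_mul_scalOp (σ : G) (a : L) :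
    grpOp L G σ * scalOp L G a = scalOp L G (σ • a) * grpOp L G σ := by
  change MulOpposite.op (scal a * grp σ⁻¹) = MulOpposite.op (grp σ⁻¹ * scal (σ • a))
  simp [grp, scal, SkewMonoidAlgebra.single_mul_single]

theorem scalOp_mul_grpOp_inv (σ : G) (a : L) :
    scalOp L G a * grpOp L G σ⁻¹ = MulOpposite.op (grp σ * scal a) := by
  change MulOpposite.op (scal a) * MulOpposite.op (grp σ⁻¹⁻¹) = _
  rw [inv_inv, MulOpposite.op_mul]

theorem grpOp_mul_scalOp_eq (σ : G) (a : L) :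
    grpOp L G σ * scalOp L G a = MulOpposite.op (scal a * grp σ⁻¹) := rfl

theorem rightRing_induction {p : RightRing L G → Prop} (ξ : RightRing L G) (h0 : p 0)
    (hadd : ∀ a b, p a → p b → p (a + b)) (h : ∀ a σ, p (scalOp L G a * grpOp L G σ)) : p ξ := by
  obtain ⟨ξ, rfl⟩ := MulOpposite.op_surjective ξ
  induction ξ using SkewMonoidAlgebra.induction_on with
  | zero => exact h0
  | single σ a =>
    have := h (σ⁻¹ • a) σ⁻¹
    rw [scalOp_mul_grpOp_inv] at this
    simpa [grp, scal, SkewMonoidAlgebra.single_mul_single] using this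
  | add x y hx hy => exact hadd _ _ hx hy

variable [Algebra K L] [SMulCommClass G K L]

theorem scalOp_smul (c : K) (a : L) : scalOp L G (c • a) = c • scalOp L G a := by
  change MulOpposite.op (scal (c • a)) = c • MulOpposite.op (scal a)
  rw [← MulOpposite.op_smul, scal, scal, SkewMonoidAlgebra.smul_single]

theorem scalOp_algebraMap (c : K) : scalOp L G (algebraMap K L c) = c • 1 := by
  rw [Algebra.algebraMap_eq_smul_one, scalOp_smul, map_one]

omit [SMulCommClass G K L] in
theorem finiteDimensional_rightRing [Finite G] [FiniteDimensional K L] :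
    FiniteDimensional K (RightRing L G) :=
  have : FiniteDimensional K (TwistedGroupRing L G) :=
    Module.Finite.equiv (SkewMonoidAlgebra.coeffLinearEquiv (S := K) (k := L) (G := G)).symm
  Module.Finite.equiv (MulOpposite.opLinearEquiv K (M := TwistedGroupRing L G))

end RightRing

/-! ### Averaging `K`-linear maps into module homomorphisms. -/

section Average

variable {K L G ι : Type*} [Field K] [Field L] [Group G] [MulSemiringAction G L]
  [Algebra K L] [SMulCommClass G K L] [Fintype G] [Fintype ι]
  {V W : Type*} [AddCommGroup V] [Module (RightRing L G) V] [Module K V]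
  [IsScalarTower K (RightRing L G) V]
  [AddCommGroup W] [Module (RightRing L G) W] [Module K W] [IsScalarTower K (RightRing L G) W]

/-- The sum of the maps `v ↦ f (v y'_l σ⁻¹) σ y_l`. -/
noncomputable def average (y y' : ι → L) (f : V →ₗ[K] W) : V →ₗ[K] W :=
  ∑ σ : G, ∑ l, Algebra.lsmul K K W (scalOp L G (y l) * grpOp L G σ⁻¹) ∘ₗ f ∘ₗ
    Algebra.lsmul K K V (grpOp L G σ * scalOp L G (y' l))

theorem average_apply (y y' : ι → L) (f : V →ₗ[K] W) (v : V) :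
    average (G := G) y y' f v = ∑ σ : G, ∑ l, (scalOp L G (y l) * grpOp L G σ⁻¹) •
      f ((grpOp L G σ * scalOp L G (y' l)) • v) := by
  simp [average, mul_smul]

variable [DecidableEq ι] {y : Module.Basis ι K L} {y' : ι → L}

theorem average_scalOp_smul
    (hy : ∀ l m, Algebra.trace K L (y l * y' m) = if l = m then 1 else 0)
    (f : V →ₗ[K] W) (a : L) (v : V) :
    average (G := G) y y' f (scalOp L G a • v) = scalOp L G a • average (G := G) y y' f v := by
  simp only [average_apply, Finset.smul_sum]
  refine Finset.sum_congr rfl fun σ _ => ?_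
  have := sum_mul_dual_comm hy (LinearMap.mk₂ K
    (fun b d => (scalOp L G b * grpOp L G σ⁻¹) • f ((grpOp L G σ * scalOp L G d) • v))
    (fun _ _ _ => by rw [map_add, add_mul, add_smul])
    (fun k b d => by rw [scalOp_smul, smul_mul_assoc, smul_assoc])
    (fun _ _ _ => by rw [map_add, mul_add, add_smul, map_add, smul_add])
    (fun k b d => by rw [scalOp_smul, mul_smul_comm, smul_assoc, map_smul, smul_comm])) a
  simp only [LinearMap.mk₂_apply] at this
  simp only [← mul_smul, mul_assoc, ← map_mul, mul_comm _ a]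
  simpa only [← mul_assoc, ← map_mul, mul_smul] using this.symm

theorem average_grpOp_smul
    (hy : ∀ l m, Algebra.trace K L (y l * y' m) = if l = m then 1 else 0)
    (f : V →ₗ[K] W) (ρ : G) (v : V) :
    average (G := G) y y' f (grpOp L G ρ • v) = grpOp L G ρ • average (G := G) y y' f v := by
  simp only [average_apply, Finset.smul_sum]
  rw [← Equiv.sum_comp (Equiv.mulRight ρ⁻¹)]
  refine Finset.sum_congr rfl fun σ _ => ?_
  -- The action of `ρ` preserves the trace form, so its adjoint is `ρ⁻¹`; this makes the Casimir
  -- tensor invariant under `G`.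
  have := sum_dual_adjoint hy (LinearMap.mk₂ K
    (fun b d => (scalOp L G b * grpOp L G (ρ * σ⁻¹)) • f ((grpOp L G (σ * ρ⁻¹) *
      scalOp L G (ρ • d) * grpOp L G ρ) • v))
    (fun _ _ _ => by rw [map_add, add_mul, add_smul])
    (fun k b d => by rw [scalOp_smul, smul_mul_assoc, smul_assoc])
    (fun _ _ _ => by rw [smul_add, map_add, mul_add, add_mul, add_smul, map_add, smul_add])
    (fun k b d => by rw [smul_comm ρ k d, scalOp_smul, mul_smul_comm, smul_mul_assoc, smul_assoc,
      map_smul, smul_comm]))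
    (ρ • ·) (ρ⁻¹ • ·) (fun a b => by
      rw [← Algebra.trace_eq_of_algEquiv (MulSemiringAction.toAlgEquiv K L ρ) (a * _)]
      simp)
  simp only [LinearMap.mk₂_apply, smul_inv_smul] at this
  simp only [Equiv.coe_mulRight, mul_inv_rev, inv_inv, ← mul_smul]
  refine Eq.trans ?_ (this.symm.trans ?_)
  · rfl
  · refine Finset.sum_congr rfl fun l _ => ?_
    rw [mul_assoc, ← grpOp_mul_scalOp, ← mul_assoc, ← map_mul, inv_mul_cancel_right, map_mul,
      ← mul_assoc, ← grpOp_mul_scalOp, mul_assoc]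

/-- The average of a `K`-linear map is linear over the twisted group ring. -/
noncomputable def averageHom (hy : ∀ l m, Algebra.trace K L (y l * y' m) = if l = m then 1 else 0)
    (f : V →ₗ[K] W) : V →ₗ[RightRing L G] W where
  toFun := average (G := G) y y' f
  map_add' := map_add _
  map_smul' ξ v := by
    induction ξ using rightRing_induction with
    | h0 => simp
    | hadd a b ha hb =>
      simp only [RingHom.id_apply] at ha hb ⊢
      rw [add_smul, map_add, ha, hb, add_smul]
    | h a σ =>
      rw [mul_smul, average_scalOp_smul hy, average_grpOp_smul hy, RingHom.id_apply, mul_smul]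

theorem averageHom_apply (hy : ∀ l m, Algebra.trace K L (y l * y' m) = if l = m then 1 else 0)
    (f : V →ₗ[K] W) (v : V) : averageHom (G := G) hy f v =
      ∑ σ : G, ∑ l, MulOpposite.op (grp σ * scal (y l)) •
        f (MulOpposite.op (scal (y' l) * grp σ⁻¹) • v) := by
  refine (average_apply _ _ _ _).trans ?_
  simp only [scalOp_mul_grpOp_inv, grpOp_mul_scalOp_eq]

variable [Algebra.IsInvariant K L G]

/-- Cyclicity of the trace gathers the ring elements around `f`; since `∑ y_l y_l^* = 1`, they add
up to `∑ σ • z = n Tr z = n`. -/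
theorem trace_scalOp_comp_averageHom
    (hy : ∀ l m, Algebra.trace K L (y l * y' m) = if l = m then 1 else 0)
    {z : L} (hz : Algebra.trace K L z = 1) (f : V →ₗ[K] V) :
    LinearMap.trace K V (Algebra.lsmul K K V (scalOp L G z) *
      (averageHom (G := G) hy f).restrictScalars K) =
      (Nat.card (opKernel L G) : ℕ) * LinearMap.trace K V f := by
  have h1 : (averageHom (G := G) hy f).restrictScalars K = average (G := G) y y' f := rfl
  have h2 : ∀ σ : G, ∑ l, (grpOp L G σ * scalOp L G (y' l)) *
      (scalOp L G z * (scalOp L G (y l) * grpOp L G σ⁻¹)) = scalOp L G (σ • z) := by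
    intro σ
    have : ∀ l, (grpOp L G σ * scalOp L G (y' l)) *
        (scalOp L G z * (scalOp L G (y l) * grpOp L G σ⁻¹)) =
        grpOp L G σ * scalOp L G (y l * y' l * z) * grpOp L G σ⁻¹ := fun l => by
      rw [show y l * y' l * z = y' l * (z * y l) by ring]
      simp only [map_mul, mul_assoc]
    simp only [this]
    rw [← Finset.sum_mul, ← Finset.mul_sum, ← map_sum, ← Finset.sum_mul, sum_mul_dual hy, one_mul,
      grpOp_mul_scalOp, mul_assoc, ← map_mul, mul_inv_cancel, map_one, mul_one]
  have h3 : ∀ A B : RightRing L G, LinearMap.trace K V (Algebra.lsmul K K V (scalOp L G z) *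
      (Algebra.lsmul K K V A * (f * Algebra.lsmul K K V B))) =
      LinearMap.trace K V (f * Algebra.lsmul K K V (B * (scalOp L G z * A))) := by
    intro A B
    rw [← mul_assoc, LinearMap.trace_mul_comm, map_mul (Algebra.lsmul K K V),
      map_mul (Algebra.lsmul K K V), mul_assoc]
  have h4 : average (G := G) y y' f = ∑ σ : G, ∑ l,
    Algebra.lsmul K K V (scalOp L G (y l) * grpOp L G σ⁻¹) *
    (f * Algebra.lsmul K K V (grpOp L G σ * scalOp L G (y' l))) := rfl
  rw [h1, h4]
  simp only [Finset.mul_sum, map_sum, h3]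
  simp only [← map_sum, ← Finset.mul_sum, h2]
  rw [← card_opKernel_smul_trace K L G z, hz, map_one, map_nsmul, map_one, map_nsmul, map_one,
    mul_smul_comm, mul_one, map_nsmul, nsmul_eq_mul]

end Average

end TwistedGroupRing

namespace TwistedGroupRing

/-! ### The trace form on the endomorphism skew field of a simple module. -/

section Simple

variable {K L G : Type*} [Field K] [Field L] [Group G] [MulSemiringAction G L]
  [Algebra K L] [SMulCommClass G K L]
  (X : Type*) [AddCommGroup X] [Module (RightRing L G) X] [Module K X]
  [IsScalarTower K (RightRing L G) X] [IsSimpleModule (RightRing L G) X]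

variable (K) in
theorem finiteDimensional_simple [Finite G] [FiniteDimensional K L] : FiniteDimensional K X := by
  have := finiteDimensional_rightRing (K := K) (L := L) (G := G)
  have := IsSimpleModule.nontrivial (RightRing L G) X
  obtain ⟨x, hx⟩ := exists_ne (0 : X)
  exact Module.Finite.of_surjective
    ((LinearMap.toSpanSingleton (RightRing L G) X x).restrictScalars K)
    (IsSimpleModule.toSpanSingleton_surjective (RightRing L G) hx)

variable (K) in
omit [IsSimpleModule (RightRing L G) X] in
theorem finiteDimensional_endRing [FiniteDimensional K X] :
    FiniteDimensional K (EndRing L G X) :=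
  Module.Finite.of_injective
    (LinearMap.restrictScalarsₗ K (RightRing L G) X X K : EndRing L G X →ₗ[K] (X →ₗ[K] X))
    (LinearMap.restrictScalars_injective K)

theorem finiteDimensional_center (K D : Type*) [Field K] [Ring D] [Algebra K D]
    [FiniteDimensional K D] : FiniteDimensional K (Subring.center D) :=
  Module.Finite.of_injective
    ({ toFun := Subtype.val, map_add' := fun _ _ => rfl, map_smul' := fun _ _ => rfl } :
      Subring.center D →ₗ[K] D) Subtype.val_injective

variable [Algebra.IsInvariant K L G] [Fintype G] {ι : Type*} [Fintype ι] [DecidableEq ι]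
  {y : Module.Basis ι K L} {y' : ι → L}

/-- Average the rank-one map `w ↦ f(w) x`, whose trace is `f x ≠ 0`. -/
theorem exists_trace_scalOp_mul_ne_zero
    (hn : ((Nat.card (opKernel L G) : ℕ) : K) ≠ 0)
    (hy : ∀ l m, Algebra.trace K L (y l * y' m) = if l = m then 1 else 0)
    {z : L} (hz : Algebra.trace K L z = 1) :
    ∃ δ : EndRing L G X, LinearMap.trace K X (Algebra.lsmul K K X (scalOp L G z) *
      δ.restrictScalars K) ≠ 0 := by
  have := finiteDimensional_of_isInvariant K L G
  have := finiteDimensional_simple K (L := L) (G := G) X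
  have := IsSimpleModule.nontrivial (RightRing L G) X
  obtain ⟨x, hx⟩ := exists_ne (0 : X)
  obtain ⟨f, hf⟩ : ∃ f : Module.Dual K X, f x ≠ 0 := by
    by_contra! h
    exact hx ((Module.forall_dual_apply_eq_zero_iff K x).1 h)
  refine ⟨averageHom hy (f.smulRight x), ?_⟩
  rw [trace_scalOp_comp_averageHom hy hz, LinearMap.trace_smulRight]
  exact mul_ne_zero hn hf

variable {X} in
/-- A skew field `D` that operates on `X`: the form `δ ↦ tr (z δ)` with `Tr z = 1` is an integral
multiple of the reduced trace to `K`, unless it vanishes. -/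
theorem exists_trace_eq_mul_reducedTraceTo_of_ne_zero
    (hn : ((Nat.card (opKernel L G) : ℕ) : K) ≠ 0)
    (hy : ∀ l m, Algebra.trace K L (y l * y' m) = if l = m then 1 else 0)
    {z : L} (hz : Algebra.trace K L z = 1)
    {V D : Type*} [AddCommGroup V] [Module (RightRing L G) V] [Module K V]
    [IsScalarTower K (RightRing L G) V] [FiniteDimensional K V]
    [DivisionRing D] [Algebra K D] [FiniteDimensional K D] [Module D V] [IsScalarTower K D V]
    [SMulCommClass (RightRing L G) D V]
    (hne : ∃ δ : D, LinearMap.trace K V (Algebra.lsmul K K V (scalOp L G z) *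
      Algebra.lsmul K K V δ) ≠ 0) :
    schurDegree D ^ 2 = centerDegree D ∧
    ∃ r : ℕ, Module.finrank D V * schurDegree D = Module.finrank K L * r ∧
      (r : K) ≠ 0 ∧ ∀ δ : D, LinearMap.trace K V (Algebra.lsmul K K V (scalOp L G z) *
        Algebra.lsmul K K V δ) = r * reducedTraceTo K D δ := by
  have := finiteDimensional_center K D
  have : IsScalarTower K (Subring.center D) V :=
    ⟨fun c z v => (smul_assoc c (z : D) v : (c • (z : D)) • v = c • (z : D) • v)⟩
  have : FiniteDimensional (Subring.center D) D := Module.Finite.of_restrictScalars_finite K _ _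
  have : FiniteDimensional (Subring.center D) V := Module.Finite.of_restrictScalars_finite K _ _
  let lam : L →+* Module.End (Subring.center D) V :=
    (Module.toModuleEnd (Subring.center D) V).comp (scalOp L G)
  let g : G →* Module.End (Subring.center D) V :=
    ((Module.toModuleEnd (Subring.center D) V : RightRing L G →+* _) :
      RightRing L G →* _).comp (grpOp L G)
  let del : D →ₐ[Subring.center D] Module.End (Subring.center D) V := Algebra.lsmul _ _ V
  have hres : ∀ δ : D, LinearMap.trace K V (Algebra.lsmul K K V (scalOp L G z) *
      Algebra.lsmul K K V δ) = Algebra.trace K (Subring.center D)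
        (LinearMap.trace (Subring.center D) V (lam z * del δ)) := fun δ =>
    LinearMap.trace_restrictScalars_eq (K := K) (lam z * del δ)
  obtain ⟨m, r, hm, hmpos, hr, hr0, htr⟩ := exists_trace_eq_mul_reducedTrace (K := K) hn hy
    (fun d hd => ⟨⟨d, Subring.mem_center_iff.2 fun w => (hd w).symm⟩, rfl⟩) lam g
    (fun c => LinearMap.ext fun x => by
      change scalOp L G (algebraMap K L c) • x = algebraMap K (Subring.center D) c • x
      rw [scalOp_algebraMap, smul_assoc, one_smul, algebraMap_smul])
    (fun σ a => LinearMap.ext fun x => by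
      change grpOp L G σ • scalOp L G a • x = scalOp L G (σ • a) • grpOp L G σ • x
      rw [← mul_smul, grpOp_mul_scalOp, mul_smul])
    del (fun d a => LinearMap.ext fun x => (smul_comm _ _ _).symm)
    (fun d σ => LinearMap.ext fun x => (smul_comm _ _ _).symm) hz (by
      obtain ⟨δ, hδ⟩ := hne
      exact ⟨δ, fun h => hδ (by rw [hres, h, map_zero])⟩)
  have hdeg : schurDegree D = m := by
    rw [schurDegree, centerDegree, ← hm, Nat.sqrt_eq']
  refine ⟨by rw [hdeg, hm]; rfl, r, ?_, ?_, fun δ => ?_⟩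
  -- The dimension of `V` over the center is `m² · dim_D V` and also `h m r`; cancel one factor `m`.
  · refine Nat.eq_of_mul_eq_mul_left hmpos ?_
    rw [hdeg]
    calc m * (Module.finrank D V * m) = m ^ 2 * Module.finrank D V := by ring
      _ = Module.finrank K L * m * r := by
        rw [hm, Module.finrank_mul_finrank (Subring.center D) D V, hr]
      _ = _ := by ring
  · intro h
    rw [← map_natCast (algebraMap K (Subring.center D)), h, map_zero] at hr0
    exact hr0 rfl
  · rw [hres, htr, ← nsmul_eq_mul, map_nsmul, nsmul_eq_mul]
    rfl

theorem exists_trace_eq_mul_reducedTraceTo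
    (hn : ((Nat.card (opKernel L G) : ℕ) : K) ≠ 0)
    (hy : ∀ l m, Algebra.trace K L (y l * y' m) = if l = m then 1 else 0)
    {z : L} (hz : Algebra.trace K L z = 1) :
    schurDegree (EndRing L G X) ^ 2 = centerDegree (EndRing L G X) ∧
    ∃ r : ℕ, endDim L G X * schurDegree (EndRing L G X) = Module.finrank K L * r ∧
      (r : K) ≠ 0 ∧ ∀ δ : EndRing L G X,
        LinearMap.trace K X (Algebra.lsmul K K X (scalOp L G z) * δ.restrictScalars K) =
          r * reducedTraceTo K (EndRing L G X) δ := by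
  have := finiteDimensional_of_isInvariant K L G
  have := finiteDimensional_simple K (L := L) (G := G) X
  have := finiteDimensional_endRing K (L := L) (G := G) X
  exact exists_trace_eq_mul_reducedTraceTo_of_ne_zero hn hy hz
    (exists_trace_scalOp_mul_ne_zero X hn hy hz)

end Simple

end TwistedGroupRing

namespace TwistedGroupRing

/-! ### Averages of rank-one maps on a simple module. -/

section Schur

variable {K L G ι : Type*} [Field K] [Field L] [Group G] [MulSemiringAction G L]
  [Algebra K L] [SMulCommClass G K L] [Algebra.IsInvariant K L G] [Fintype G]
  [Fintype ι] [DecidableEq ι] {y : Module.Basis ι K L} {y' : ι → L}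
  {X : Type*} [AddCommGroup X] [Module (RightRing L G) X] [Module K X]
  [IsScalarTower K (RightRing L G) X] [IsSimpleModule (RightRing L G) X]

/-- Both sides lie in the skew field and pair equally with every `δ` under the reduced trace,
because `δ` can be moved onto `v`. A nonzero difference would be invertible, so every element would
be a multiple of it and the form would vanish identically. -/
theorem averageHom_smulRight_reducedTraceTo
    (hn : ((Nat.card (opKernel L G) : ℕ) : K) ≠ 0)
    (hy : ∀ l m, Algebra.trace K L (y l * y' m) = if l = m then 1 else 0)
    {z : L} (hz : Algebra.trace K L z = 1) {r : K} (hr : r ≠ 0)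
    (htr : ∀ δ : EndRing L G X,
      LinearMap.trace K X (Algebra.lsmul K K X (scalOp L G z) * δ.restrictScalars K) =
        r * reducedTraceTo K (EndRing L G X) δ)
    (χ : X →ₗ[EndRing L G X] EndRing L G X) (v : X) :
    averageHom (G := G) hy ((reducedTraceTo K (EndRing L G X) ∘ₗ χ.restrictScalars K).smulRight v) =
      algebraMap K (EndRing L G X) (((Nat.card (opKernel L G) : ℕ) : K) / r) * χ v := by
  have := finiteDimensional_of_isInvariant K L G
  have := finiteDimensional_simple K (L := L) (G := G) X
  set T : EndRing L G X := averageHom (G := G) hy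
    ((reducedTraceTo K (EndRing L G X) ∘ₗ χ.restrictScalars K).smulRight v) with hT
  have h1 : ∀ δ : EndRing L G X, r * reducedTraceTo K (EndRing L G X) (δ * T) =
      (Nat.card (opKernel L G) : ℕ) * reducedTraceTo K (EndRing L G X) (δ * χ v) := by
    intro δ
    have h2 : δ * T = averageHom (G := G) hy
        ((reducedTraceTo K (EndRing L G X) ∘ₗ χ.restrictScalars K).smulRight (δ v)) := by
      ext w
      rw [Module.End.mul_apply, hT, averageHom_apply, averageHom_apply]
      simp only [map_sum, map_smul, LinearMap.smulRight_apply]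
      refine Finset.sum_congr rfl fun σ _ => Finset.sum_congr rfl fun l _ => ?_
      rw [LinearMap.map_smul_of_tower]
    rw [← htr, h2, trace_scalOp_comp_averageHom hy hz, LinearMap.trace_smulRight]
    exact congrArg (fun t => ((Nat.card (opKernel L G) : ℕ) : K) *
      reducedTraceTo K (EndRing L G X) t) (χ.map_smul δ v)
  obtain ⟨δ₀, hδ₀⟩ := exists_trace_scalOp_mul_ne_zero X hn hy hz
  rw [htr] at hδ₀
  by_contra hne
  rw [← sub_eq_zero] at hne
  refine hδ₀ ?_
  have h3 := h1 (δ₀ * (T - algebraMap K (EndRing L G X)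
    (((Nat.card (opKernel L G) : ℕ) : K) / r) * χ v)⁻¹)
  set ε := T - algebraMap K (EndRing L G X) (((Nat.card (opKernel L G) : ℕ) : K) / r) * χ v with hε
  have h4 : δ₀ = (δ₀ * ε⁻¹) * T -
      (((Nat.card (opKernel L G) : ℕ) : K) / r) • ((δ₀ * ε⁻¹) * χ v) := by
    rw [← mul_smul_comm, Algebra.smul_def, ← mul_sub, ← hε, inv_mul_cancel_right₀ hne]
  rw [h4, map_sub, map_smul, mul_sub, h3, smul_eq_mul, ← mul_assoc, mul_div_cancel₀ _ hr, sub_self]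

end Schur

/-! ### Semisimplicity of the twisted group ring. -/

section Maschke

variable {K L G ι : Type*} [Field K] [Field L] [Group G] [MulSemiringAction G L]
  [Algebra K L] [SMulCommClass G K L] [Algebra.IsInvariant K L G] [Fintype G]
  [Fintype ι] [DecidableEq ι] {y : Module.Basis ι K L} {y' : ι → L}

/-- Maschke's theorem for the twisted group ring. -/
theorem isSemisimpleModule_of_card_opKernel_ne_zero
    (hn : ((Nat.card (opKernel L G) : ℕ) : K) ≠ 0)
    (hy : ∀ l m, Algebra.trace K L (y l * y' m) = if l = m then 1 else 0)
    {z : L} (hz : Algebra.trace K L z = 1)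
    (V : Type*) [AddCommGroup V] [Module (RightRing L G) V] [Module K V]
    [IsScalarTower K (RightRing L G) V] : IsSemisimpleModule (RightRing L G) V := by
  refine { toComplementedLattice := ⟨fun W => ?_⟩ }
  obtain ⟨π, hπ⟩ := (W.subtype.restrictScalars K).exists_leftInverse_of_injective
    (LinearMap.ker_eq_bot.2 W.subtype_injective)
  have hπ' : ∀ w : W, π w = w := fun w => LinearMap.congr_fun hπ w
  -- The factor `z` is essential: averaging `π` alone gives `g = h n` on `W`, which may vanish in
  -- `K`, whereas inserting `z` gives `n Tr z = n`.
  let P : V →ₗ[RightRing L G] W := ((Nat.card (opKernel L G) : ℕ) : K)⁻¹ •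
    averageHom (G := G) hy (Algebra.lsmul K K W (scalOp L G z) ∘ₗ π)
  refine ⟨LinearMap.ker P, LinearMap.isCompl_of_proj fun w => ?_⟩
  have h1 : ∀ σ : G, ∑ l, (scalOp L G (y l) * grpOp L G σ⁻¹) •
      (scalOp L G z • π ((grpOp L G σ * scalOp L G (y' l)) • (w : V))) =
      scalOp L G (σ⁻¹ • z) • w := by
    intro σ
    have h2 : ∀ l, (scalOp L G (y l) * grpOp L G σ⁻¹) •
        (scalOp L G z • π ((grpOp L G σ * scalOp L G (y' l)) • (w : V))) =
        scalOp L G (y l * y' l * σ⁻¹ • z) • w := by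
      intro l
      rw [← W.coe_smul, hπ', ← mul_smul, ← mul_smul]
      congr 1
      rw [mul_assoc, mul_assoc, ← mul_assoc (grpOp L G _), grpOp_mul_scalOp, mul_assoc,
        ← mul_assoc (grpOp L G _), ← map_mul, inv_mul_cancel, map_one, one_mul, ← map_mul,
        ← map_mul]
      congr 1
      ring
    simp only [h2]
    rw [← Finset.sum_smul, ← map_sum, ← Finset.sum_mul, sum_mul_dual hy, one_mul]
  have h3 : averageHom (G := G) hy (Algebra.lsmul K K W (scalOp L G z) ∘ₗ π) w =
      (Nat.card (opKernel L G)) • w := by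
    refine (average_apply _ _ _ _).trans ?_
    simp only [LinearMap.comp_apply, Algebra.lsmul_coe, h1]
    have h4 : ∑ σ : G, σ⁻¹ • z = ∑ σ : G, σ • z := Equiv.sum_comp (Equiv.inv G) fun σ => σ • z
    rw [← Finset.sum_smul, ← map_sum, h4,
      ← card_opKernel_smul_trace K L G z, hz, map_one, map_nsmul, map_one, smul_assoc, one_smul]
  rw [LinearMap.smul_apply, h3, ← Nat.cast_smul_eq_nsmul K, smul_smul, inv_mul_cancel₀ hn, one_smul]

end Maschke

/-! ### Injectivity of the Wedderburn map. -/

section Wedderburn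

variable {K : Type*} {L : Type u} {G : Type v} [Field K] [Field L] [Group G]
  [MulSemiringAction G L] [Algebra K L] [SMulCommClass G K L]
  {k : ℕ} {X : Fin k → Type*} [∀ i, AddCommGroup (X i)] [∀ i, Module (RightRing L G) (X i)]
  [∀ i, Module K (X i)] [∀ i, IsScalarTower K (RightRing L G) (X i)]

/-- The regular module is a sum of simple submodules, so an element killing all simple modules kills
`1`. -/
theorem wedderburnMap_injective [IsSemisimpleModule (RightRing L G) (RightRing L G)]
    (hXall : ∀ (M : Type (max u v)) [AddCommGroup M] [Module (RightRing L G) M]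
      [IsSimpleModule (RightRing L G) M], ∃ i, Nonempty (M ≃ₗ[RightRing L G] X i)) :
    Function.Injective (wedderburnMap K L G X) := by
  rw [injective_iff_map_eq_zero]
  intro ξ hξ
  have hkill : ∀ i (v : X i), MulOpposite.op ξ • v = 0 := fun i v => by
    have := congrArg (fun φ => (φ i).unop v) hξ
    exact this
  let N : Submodule (RightRing L G) (RightRing L G) :=
    { carrier := {x | ∀ η : RightRing L G, (∀ i (v : X i), η • v = 0) → η • x = 0}
      add_mem' := fun ha hb η hη => by rw [smul_add, ha η hη, hb η hη, add_zero]
      zero_mem' := fun η _ => smul_zero η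
      smul_mem' := fun c x hx η hη => by
        rw [← mul_smul]
        exact hx _ fun i v => by rw [mul_smul, hη] }
  have hN : N = ⊤ := by
    rw [eq_top_iff, ← IsSemisimpleModule.sSup_simples_eq_top (RightRing L G) (RightRing L G)]
    refine sSup_le fun S hS x hx η hη => ?_
    have : IsSimpleModule (RightRing L G) S := hS
    obtain ⟨i, ⟨e⟩⟩ := hXall S
    have h : η • (⟨x, hx⟩ : S) = 0 := e.injective (by rw [map_smul, hη, map_zero])
    exact congrArg Subtype.val h
  have h1 : (1 : RightRing L G) ∈ N := hN ▸ Submodule.mem_top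
  have := h1 (MulOpposite.op ξ) hkill
  rw [smul_eq_mul, mul_one] at this
  exact MulOpposite.op_eq_zero_iff ξ |>.1 this

end Wedderburn

end TwistedGroupRing

namespace TwistedGroupRing

/-! ### Schur and Fourier sums as values of averages. -/

section Fourier

variable {K L G ι : Type*} [Field K] [Field L] [Group G] [MulSemiringAction G L]
  [Algebra K L] [SMulCommClass G K L] [Algebra.IsInvariant K L G] [Fintype G]
  [Fintype ι] [DecidableEq ι] {y : Module.Basis ι K L} {y' : ι → L}
  {X X' : Type*} [AddCommGroup X] [Module (RightRing L G) X] [Module K X]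
  [IsScalarTower K (RightRing L G) X] [IsSimpleModule (RightRing L G) X]
  [AddCommGroup X'] [Module (RightRing L G) X'] [Module K X']
  [IsScalarTower K (RightRing L G) X'] [IsSimpleModule (RightRing L G) X']

omit [Algebra.IsInvariant K L G] in
theorem averageHom_eq_zero
    (hy : ∀ l m, Algebra.trace K L (y l * y' m) = if l = m then 1 else 0)
    (hX : IsEmpty (X' ≃ₗ[RightRing L G] X)) (f : X' →ₗ[K] X) :
    averageHom (G := G) hy f = 0 := by
  by_contra h
  exact hX.false (LinearEquiv.ofBijective _ (LinearMap.bijective_of_ne_zero h))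

omit [Algebra.IsInvariant K L G] [IsSimpleModule (RightRing L G) X] in
/-- A Schur sum, as a value of an average. -/
theorem sum_reducedTraceTo_smul_smul
    (hy : ∀ l m, Algebra.trace K L (y l * y' m) = if l = m then 1 else 0)
    (χ : X' →ₗ[EndRing L G X'] EndRing L G X') (v : X) (w : X') :
    ∑ σ : G, ∑ l, reducedTraceTo K (EndRing L G X')
      (χ ((operation K L G X' (scal (y' l) * grp σ⁻¹)).unop w)) •
        MulOpposite.op (grp σ * scal (y l)) • v =
      averageHom (G := G) hy
        ((reducedTraceTo K (EndRing L G X') ∘ₗ χ.restrictScalars K).smulRight v) w := by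
  rw [averageHom_apply]
  refine Finset.sum_congr rfl fun σ _ => Finset.sum_congr rfl fun l _ => ?_
  rw [LinearMap.smulRight_apply, smul_comm]
  rfl

-- Each diagonal entry in the matrix trace contributes the average of one rank-one map, evaluated at
-- the matching basis vector.
omit [Algebra.IsInvariant K L G] [IsSimpleModule (RightRing L G) X] in
theorem sum_reducedTraceTo_matrixTrace_smul_smul
    (hy : ∀ l m, Algebra.trace K L (y l * y' m) = if l = m then 1 else 0)
    {κ : Type*} [Fintype κ] (b : Module.Basis κ (EndRing L G X') X')
    (φ : (Module.End (EndRing L G X') X')ᵐᵒᵖ) (v : X) :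
    ∑ σ : G, ∑ l, reducedTraceTo K (EndRing L G X')
      (matrixTrace b (operation K L G X' (scal (y' l) * grp σ⁻¹) * φ)) •
        MulOpposite.op (grp σ * scal (y l)) • v =
      ∑ a, averageHom (G := G) hy ((reducedTraceTo K (EndRing L G X') ∘ₗ
        (b.coord a ∘ₗ φ.unop).restrictScalars K).smulRight v) (b a) := by
  symm
  simp only [← sum_reducedTraceTo_smul_smul hy]
  rw [Finset.sum_comm]
  refine Finset.sum_congr rfl fun σ _ => ?_
  rw [Finset.sum_comm]
  refine Finset.sum_congr rfl fun l _ => ?_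
  rw [← Finset.sum_smul, matrixTrace, map_sum]
  rfl

end Fourier

end TwistedGroupRing

/-! ### Fourier inversion and the Schur relations. -/

open TwistedGroupRing in
theorem mainTheorem8 {K : Type t} {L : Type u} {G : Type v} [Field K] [Field L] [Group G]
    [Fintype G] [MulSemiringAction G L]
    -- `K` is the fixed field of the operation of `G` on `L`
    [Algebra K L] [SMulCommClass G K L] [Algebra.IsInvariant K L G]
    -- the order `n` of the kernel `N` of the operation is invertible in `K`
    (hn : ((Nat.card (opKernel L G) : ℕ) : K) ≠ 0)
    -- a `K`-basis of `L` and its dual basis with respect to the trace form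
    (y : Module.Basis (Fin (Module.finrank K L)) K L) (y' : Fin (Module.finrank K L) → L)
    (hy : ∀ l m, Algebra.trace K L (y l * y' m) = if l = m then 1 else 0)
    -- a complete set of pairwise nonisomorphic simple right modules
    {k : ℕ} (X : Fin k → Type w) [∀ i, AddCommGroup (X i)] [∀ i, Module (RightRing L G) (X i)]
    [∀ i, Module K (X i)] [∀ i, IsScalarTower K (RightRing L G) (X i)]
    [∀ i, IsSimpleModule (RightRing L G) (X i)]
    (hX : ∀ i j, Nonempty (X i ≃ₗ[RightRing L G] X j) → i = j)
    (hXall : ∀ (M : Type (max u v)) [AddCommGroup M] [Module (RightRing L G) M]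
      [IsSimpleModule (RightRing L G) M], ∃ i, Nonempty (M ≃ₗ[RightRing L G] X i))
    -- bases of the simple modules over their endomorphism skew fields
    (b : ∀ i, Module.Basis (Fin (endDim L G (X i))) (EndRing L G (X i)) (X i)) :
    -- the numbers `d_i` and `x_i d_i / h` are well defined, and the latter are invertible in `K`
    (∀ i, schurDegree (EndRing L G (X i)) ^ 2 = centerDegree (EndRing L G (X i))) ∧
    (∀ i, Module.finrank K L ∣ endDim L G (X i) * schurDegree (EndRing L G (X i)) ∧
      ((endDim L G (X i) * schurDegree (EndRing L G (X i)) / Module.finrank K L : ℕ) : K) ≠ 0) ∧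
    -- Fourier inversion
    (∃ Ω : TwistedGroupRing L G ≃ₐ[K] (∀ i, (Module.End (EndRing L G (X i)) (X i))ᵐᵒᵖ),
      (∀ ξ, Ω ξ = wedderburnMap K L G X ξ) ∧
      ∀ φ : ∀ i, (Module.End (EndRing L G (X i)) (X i))ᵐᵒᵖ,
        Ω.symm φ = ((Nat.card (opKernel L G) : ℕ) : K)⁻¹ • ∑ σ : G, ∑ l,
          (∑ i, ((endDim L G (X i) * schurDegree (EndRing L G (X i)) / Module.finrank K L : ℕ) : K)
              * reducedTraceTo K (EndRing L G (X i))
                (matrixTrace (b i) (operation K L G (X i) (scal (y' l) * grp σ⁻¹) * φ i)))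
            • (grp σ * scal (y l) : TwistedGroupRing L G)) ∧
    -- Schur relations; the scalar `g / (x_i d_i)` is `n / (x_i d_i / h)`
    (∀ (i i' : Fin k) (a c : Fin (endDim L G (X i))) (a' c' : Fin (endDim L G (X i'))),
      (if (⟨i, a, c⟩ : Σ j, Fin (endDim L G (X j)) × Fin (endDim L G (X j))) = ⟨i', a', c'⟩ then
        algebraMap K (EndRing L G (X i)) (((Nat.card (opKernel L G) : ℕ) : K) /
          ((endDim L G (X i) * schurDegree (EndRing L G (X i)) / Module.finrank K L : ℕ) : K))
        else 0) =
      ∑ l, ∑ σ : G,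
        matrixEntry (b i) (operation K L G (X i) (grp σ * scal (y l))) a c *
          algebraMap K (EndRing L G (X i)) (reducedTraceTo K (EndRing L G (X i'))
            (matrixEntry (b i') (operation K L G (X i') (scal (y' l) * grp σ⁻¹)) c' a'))) := by
  have := finiteDimensional_of_isInvariant K L G
  have hpos : 0 < Module.finrank K L := Module.finrank_pos
  have : Nonempty (Fin (Module.finrank K L)) := ⟨⟨0, hpos⟩⟩
  obtain ⟨z, hz⟩ := exists_trace_eq_one hy
  have hsq := fun i => (exists_trace_eq_mul_reducedTraceTo (X i) hn hy hz).1
  choose r hr hr0 htr using fun i => (exists_trace_eq_mul_reducedTraceTo (X i) hn hy hz).2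
  have hdiv : ∀ i, endDim L G (X i) * schurDegree (EndRing L G (X i)) / Module.finrank K L = r i :=
    fun i => by rw [hr, Nat.mul_div_cancel_left _ hpos]
  have hne : ∀ i j, i ≠ j → IsEmpty (X i ≃ₗ[RightRing L G] X j) := fun i j hij =>
    not_nonempty_iff.1 fun h => hij (hX i j h)
  -- Both main claims follow from this formula together with the vanishing of averages between
  -- different simple modules.
  have hav : ∀ i (χ : X i →ₗ[EndRing L G (X i)] EndRing L G (X i)) (v w : X i),
      averageHom (G := G) hy
        ((reducedTraceTo K (EndRing L G (X i)) ∘ₗ χ.restrictScalars K).smulRight v) w =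
      (((Nat.card (opKernel L G) : ℕ) : K) / r i) • χ v w := fun i χ v w => by
    rw [averageHom_smulRight_reducedTraceTo hn hy hz (hr0 i) (htr i) χ v, ← Algebra.smul_def]
    rfl
  simp only [hdiv]
  refine ⟨hsq, fun i => ⟨⟨r i, hr i⟩, hr0 i⟩, ?_, ?_⟩
  · have := isSemisimpleModule_of_card_opKernel_ne_zero hn hy hz (RightRing L G)
    have hinv : ∀ φ : ∀ i, (Module.End (EndRing L G (X i)) (X i))ᵐᵒᵖ,
        wedderburnMap K L G X (((Nat.card (opKernel L G) : ℕ) : K)⁻¹ • ∑ σ : G, ∑ l,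
          (∑ i, (r i : K) * reducedTraceTo K (EndRing L G (X i))
                (matrixTrace (b i) (operation K L G (X i) (scal (y' l) * grp σ⁻¹) * φ i)))
            • (grp σ * scal (y l) : TwistedGroupRing L G)) = φ := by
      intro φ
      funext j
      refine MulOpposite.unop_injective (LinearMap.ext fun v => ?_)
      change MulOpposite.op (((Nat.card (opKernel L G) : ℕ) : K)⁻¹ • ∑ σ : G, ∑ l,
          (∑ i, (r i : K) * reducedTraceTo K (EndRing L G (X i))
                (matrixTrace (b i) (operation K L G (X i) (scal (y' l) * grp σ⁻¹) * φ i)))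
            • (grp σ * scal (y l) : TwistedGroupRing L G)) • v = (φ j).unop v
      have h1 : ∀ i, ∑ σ : G, ∑ l, reducedTraceTo K (EndRing L G (X i))
          (matrixTrace (b i) (operation K L G (X i) (scal (y' l) * grp σ⁻¹) * φ i)) •
            MulOpposite.op (grp σ * scal (y l)) • v =
          if i = j then (((Nat.card (opKernel L G) : ℕ) : K) / r j) • (φ j).unop v else 0 := by
        intro i
        rw [sum_reducedTraceTo_matrixTrace_smul_smul hy]
        split_ifs with hij
        · subst hij
          -- The sum becomes `n / r` times the expansion of `φ v` in the basis `b i`.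
          simp only [hav]
          simp only [← Finset.smul_sum]
          exact congrArg _ ((b i).sum_repr _)
        · exact Finset.sum_eq_zero fun a _ => by
            rw [averageHom_eq_zero hy (hne i j hij), LinearMap.zero_apply]
      have h2 : ∑ σ : G, ∑ l, (∑ i, (r i : K) * reducedTraceTo K (EndRing L G (X i))
          (matrixTrace (b i) (operation K L G (X i) (scal (y' l) * grp σ⁻¹) * φ i))) •
            MulOpposite.op (grp σ * scal (y l)) • v =
          ∑ i, (r i : K) • ∑ σ : G, ∑ l, reducedTraceTo K (EndRing L G (X i))
            (matrixTrace (b i) (operation K L G (X i) (scal (y' l) * grp σ⁻¹) * φ i)) •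
              MulOpposite.op (grp σ * scal (y l)) • v := by
        simp only [Finset.smul_sum, Finset.sum_smul, mul_smul]
        symm
        rw [Finset.sum_comm]
        exact Finset.sum_congr rfl fun σ _ => Finset.sum_comm
      rw [MulOpposite.op_smul, smul_assoc]
      simp only [Finset.op_sum, MulOpposite.op_smul, Finset.sum_smul (s := (Finset.univ : Finset G)),
        Finset.sum_smul (s := (Finset.univ : Finset (Fin (Module.finrank K L)))), smul_assoc]
      rw [h2]
      simp only [h1, smul_ite, smul_zero, Finset.sum_ite_eq', Finset.mem_univ, if_true]
      rw [smul_smul (r j : K), mul_div_cancel₀ _ (hr0 j), smul_smul, inv_mul_cancel₀ hn, one_smul]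
    refine ⟨AlgEquiv.ofBijective (wedderburnMap K L G X)
      ⟨wedderburnMap_injective hXall, fun φ => ⟨_, hinv φ⟩⟩, fun ξ => rfl, fun φ => ?_⟩
    rw [AlgEquiv.symm_apply_eq]
    exact (hinv φ).symm
  · intro i i' a c a' c'
    -- Each term is the `c`-th coordinate of a term of the average for `χ = coord a'` and `v = b i
    -- a`, evaluated at `b i' c'`.
    have h1 : ∀ l (σ : G), matrixEntry (b i) (operation K L G (X i) (grp σ * scal (y l))) a c *
          algebraMap K (EndRing L G (X i)) (reducedTraceTo K (EndRing L G (X i'))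
            (matrixEntry (b i') (operation K L G (X i') (scal (y' l) * grp σ⁻¹)) c' a')) =
        (b i).coord c (reducedTraceTo K (EndRing L G (X i')) ((b i').coord a'
          ((operation K L G (X i') (scal (y' l) * grp σ⁻¹)).unop (b i' c'))) •
        MulOpposite.op (grp σ * scal (y l)) • b i a) := by
      intro l σ
      rw [LinearMap.map_smul_of_tower, ← Algebra.commutes, ← Algebra.smul_def]
      rfl
    simp only [h1]
    rw [Finset.sum_comm]
    simp only [← map_sum]
    rw [sum_reducedTraceTo_smul_smul hy]
    by_cases hii : i' = i
    · subst hii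
      rw [hav, LinearMap.map_smul_of_tower]
      simp only [Sigma.mk.injEq, heq_eq_eq, Prod.mk.injEq, true_and, Module.Basis.coord_apply,
        Module.Basis.repr_self, Finsupp.single_apply]
      by_cases ha : a = a'
      · by_cases hc : c = c'
        · rw [if_pos ⟨ha, hc⟩, if_pos ha, Module.End.one_apply, Module.Basis.repr_self,
            Finsupp.single_apply, if_pos hc.symm, Algebra.algebraMap_eq_smul_one]
        · rw [if_neg fun h => hc h.2, if_pos ha, Module.End.one_apply, Module.Basis.repr_self,
            Finsupp.single_apply, if_neg (Ne.symm hc), smul_zero]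
      · rw [if_neg fun h => ha h.1, if_neg ha, LinearMap.zero_apply, map_zero, Finsupp.zero_apply,
          smul_zero]
    · rw [averageHom_eq_zero hy (hne i' i hii), LinearMap.zero_apply, map_zero, if_neg]
      rintro h
      exact hii (congrArg Sigma.fst h).symm
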